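/- Let $p>2$ be a prime and let $R$ be an integral domain of characteristic zero that is $p$-adically complete and separated, with a ring endomorphism $\sigma:R\to R$ such that $\sigma(r)\equiv r^p \pmod{pR}$ for all $r\in R$. Let $f\in R[x_1^{\pm1},\dots,x_n^{\pm1}]$ have Newton polytope $\Delta\subset\mathbb R^n$ (the convex hull of the support of $f$), and let $\mathbf b$ be a vertex of $\Delta$ such that the coefficient $f_{\mathbf b}$ of $\mathbf x^{\mathbf b}$ in $f$ is a unit of $R$. Let $\mu\subseteq\Delta$ be open in the topology whose closed sets are the unions of faces of $\Delta$, and put $\mu_{\mathbb Z}=\mu\cap\mathbb Z^n$, $h=\#\mu_{\mathbb Z}$. Let $\Omega_f(\mu)$ be the $R$-module of rational functions spanned by $$\omega_{(u_0,\mathbf u)}=(u_0-1)!\,\frac{\mathbf x^{\mathbf u}}{f(\mathbf x)^{u_0}},\qquad u_0\in\mathbb Z_{\ge1},\ \mathbf u\in u_0\mu\cap\mathbb Z^n,$$ write $\omega_{\mathbf u}=\omega_{(1,\mathbf u)}$ for $\mathbf u\in\mu_{\mathbb Z}$, and let $\widehat\Omega_f(\mu)=\varprojlim_s\Omega_f(\mu)/p^s\Omega_f(\mu)$.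 Let $\Omega_{\rm formal}$ be the $R$-module of formal series $\sum_{\mathbf k}a_{\mathbf k}\mathbf x^{\mathbf k}$, $a_{\mathbf k}\in R$, over the integral points $\mathbf k$ of the cone $\{\lambda(\mathbf v-\mathbf b):\mathbf v\in\Delta,\ \lambda\ge0\}$, and let $d\Omega_{\rm formal}$ be the $R$-span of the series $x_i\frac{\partial}{\partial x_i}a$ with $a\in\Omega_{\rm formal}$, $1\le i\le n$. Writing $f=f_{\mathbf b}\mathbf x^{\mathbf b}(1+\ell)$ and expanding the powers of $(1+\ell)^{-1}$ as geometric (binomial) series gives a formal expansion map $\Omega_f(\mu)\to\Omega_{\rm formal}$, which extends $p$-adically to $\widehat\Omega_f(\mu)$. Let $U_f(\mu)\subseteq\widehat\Omega_f(\mu)$ be the submodule of the elements whose formal expansion lies in $d\Omega_{\rm formal}$. Suppose that the Hasse–Witt matrix $\beta_p(\mu)$, the $h\times h$ matrix whose entry at $(\mathbf u,\mathbf v)\in\mu_{\mathbb Z}^2$ is the coefficient of $\mathbf x^{p\mathbf v-\mathbf u}$ in $f^{p-1}$, is invertible over $R$. Then the quotient $Q_f(\mu)=\widehat\Omega_f(\mu)/U_f(\mu)$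 is a free $R$-module of rank $h$, with a basis given by the images of $\omega_{\mathbf u}$, $\mathbf u\in\mu_{\mathbb Z}$. -/

import Mathlib

noncomputable section

namespace UnitRootCrystal

variable {R : Type*} [CommRing R] {n : ℕ}

/-- Laurent polynomials in `x_1, …, x_n` over `R`. -/
abbrev Laurent (R : Type*) [CommRing R] (n : ℕ) : Type _ := AddMonoidAlgebra R (Fin n → ℤ)

/-- The monomial `c x^u`. -/
abbrev mono (u : Fin n → ℤ) (c : R) : Laurent R n := AddMonoidAlgebra.single u c

/-- An integral vector, seen in `ℝ^n`. -/
def toReal (u : Fin n → ℤ) : Fin n → ℝ := fun i => (u i : ℝ)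

/-- The Newton polytope `Δ` of `f`: the convex hull in `ℝ^n` of the support of `f`. -/
def newton (f : Laurent R n) : Set (Fin n → ℝ) :=
  convexHull ℝ (toReal '' {u | f.coeff u ≠ 0})

/-- `b` is a vertex of the Newton polytope of `f`. -/
def IsVertex (f : Laurent R n) (b : Fin n → ℤ) : Prop :=
  toReal b ∈ (newton f).extremePoints ℝ

/-- A subset `μ ⊆ Δ` that is open in the face topology, the topology on `Δ` whose closed sets are
the unions of faces of `Δ`. The faces of a polytope are its exposed subsets: the empty face, and
the sets of maximizers of linear functionals, with `Δ` itself among them. -/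
structure FaceOpen (f : Laurent R n) where
  carrier : Set (Fin n → ℝ)
  subset : carrier ⊆ newton f
  isOpen : ∃ faces : Set (Set (Fin n → ℝ)),
    (∀ F ∈ faces, IsExposed ℝ (newton f) F) ∧ newton f \ carrier = ⋃₀ faces

/-- The set `μ_ℤ` of integral points of `μ`. -/
def FaceOpen.lattice {f : Laurent R n} (μ : FaceOpen f) : Set (Fin n → ℤ) :=
  {u | toReal u ∈ μ.carrier}

theorem FaceOpen.finite_lattice {f : Laurent R n} (μ : FaceOpen f) : μ.lattice.Finite := by
  have hs : (toReal '' {u : Fin n → ℤ | f.coeff u ≠ 0}).Finite := by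
    refine Set.Finite.image _ ?_
    refine (f.coeff.support.finite_toSet).subset fun u hu => ?_
    simpa using hu
  have hb : Bornology.IsBounded (newton f) := (isBounded_convexHull).2 hs.isBounded
  obtain ⟨C, hC⟩ := hb.exists_norm_le
  refine (Set.finite_Icc (fun _ : Fin n => -⌈C⌉) (fun _ => ⌈C⌉)).subset fun u hu => ?_
  have h1 : ∀ i, |(u i : ℝ)| ≤ C := fun i => by
    have h2 := (norm_le_pi_norm (toReal u) i).trans (hC _ (μ.subset hu))
    simpa [toReal, Real.norm_eq_abs] using h2
  constructor <;> intro i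
  · have := (abs_le.1 (h1 i)).1
    have h3 : (-⌈C⌉ : ℝ) ≤ u i := by linarith [Int.le_ceil C]
    exact_mod_cast h3
  · have := (abs_le.1 (h1 i)).2
    have h3 : (u i : ℝ) ≤ (⌈C⌉ : ℝ) := by linarith [Int.le_ceil C]
    exact_mod_cast h3

instance FaceOpen.fintypeLattice {f : Laurent R n} (μ : FaceOpen f) : Fintype μ.lattice := μ.finite_lattice.fintype

/-- The matrices `β_m(μ)`, with the coefficient of `x^{m v - u}` in `f^{m - 1}` at `(u, v)`, for
`m ≥ 1`; the Hasse–Witt matrix relative to `μ` is `β_p(μ)`. -/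
def hasseWitt (m : ℕ) (f : Laurent R n) (μ : FaceOpen f) : Matrix μ.lattice μ.lattice R :=
  Matrix.of fun u v => (f ^ (m - 1)).coeff ((m : ℤ) • (v : Fin n → ℤ) - (u : Fin n → ℤ))

/-! ### Rational functions -/

/-- The ring of rational functions `g / f^m` with `g` a Laurent polynomial. -/
abbrev RegFun (f : Laurent R n) : Type _ := Localization.Away f

/-- The function `ω_{(k, u)} = (k - 1)! x^u / f^k`, for `k ≥ 1`. -/
def omega (f : Laurent R n) (k : ℕ) (u : Fin n → ℤ) : RegFun f :=
  (Nat.factorial (k - 1) : R) •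
    (algebraMap (Laurent R n) (RegFun f) (mono u 1) * IsLocalization.Away.invSelf f ^ k)

/-- The set `C(μ)_ℤ^+` of non-zero integral points `(k, u)` of the cone
`C(μ) = {λ (1, v) | v ∈ μ, λ ≥ 0}`: here `λ = k` is a positive integer. -/
def conePoints {f : Laurent R n} (μ : FaceOpen f) : Set (ℕ × (Fin n → ℤ)) :=
  {w | 0 < w.1 ∧ ∃ v ∈ μ.carrier, toReal w.2 = (w.1 : ℝ) • v}

/-- The module `Ω_f(μ)`, generated over `R` by the `ω_{(k, u)}` with `(k, u)` in `C(μ)_ℤ^+`. -/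
def Omega {f : Laurent R n} (μ : FaceOpen f) : Submodule R (RegFun f) :=
  Submodule.span R ((fun w => omega f w.1 w.2) '' conePoints μ)

theorem omega_mem {f : Laurent R n} (μ : FaceOpen f) (u : μ.lattice) :
    omega f 1 (u : Fin n → ℤ) ∈ Omega μ :=
  Submodule.subset_span ⟨(1, u), ⟨Nat.one_pos, toReal u, u.2, by simp⟩, rfl⟩

/-! ### Formal expansion at a vertex -/

/-- For `f_b` a unit, the Laurent polynomial `h` such that `f = f_b x^b (1 + h)`. -/
def tail (f : Laurent R n) (b : Fin n → ℤ) (hu : IsUnit (f.coeff b)) : Laurent R n :=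
  mono (-b) ((hu.unit⁻¹ : Rˣ) : R) * f - 1

/-- The formal expansion of `g / f^m`, as the family of its coefficients: it is
`g x^{-m b} f_b^{-m} (1 + h)^{-m} = ∑_k (-1)^k (m + k - 1 choose k) g x^{-m b} f_b^{-m} h^k`,
where `f = f_b x^b (1 + h)`. When `b` is a vertex, only finitely many `k` contribute to each
coefficient. -/
def series (f : Laurent R n) (b : Fin n → ℤ) (hu : IsUnit (f.coeff b)) (g : Laurent R n) (m : ℕ) :
    (Fin n → ℤ) → R :=
  fun e => ∑ᶠ k : ℕ, (-1 : R) ^ k * (Nat.multichoose m k : R) *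
    (g * mono (-b) ((hu.unit⁻¹ : Rˣ) : R) ^ m * tail f b hu ^ k).coeff e

/-- A linear functional that is minimal on `Δ` at the vertex `b` only. -/
theorem exists_functional {f : Laurent R n} {b : Fin n → ℤ} (hv : IsVertex f b) :
    ∃ l : (Fin n → ℝ) →L[ℝ] ℝ, ∀ a, f.coeff a ≠ 0 → a ≠ b → l (toReal b) < l (toReal a) := by
  have hs : (toReal '' {u : Fin n → ℤ | f.coeff u ≠ 0}).Finite := by
    refine Set.Finite.image _ ?_
    refine (f.coeff.support.finite_toSet).subset fun u hu => ?_
    simpa using hu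
  set S := toReal '' {u : Fin n → ℤ | f.coeff u ≠ 0} with hS
  have hconv : Convex ℝ (newton f \ {toReal b}) :=
    ((convex_convexHull ℝ S).mem_extremePoints_iff_convex_sdiff.1 hv).2
  have hnot : toReal b ∉ convexHull ℝ (S \ {toReal b}) := by
    intro h
    have h2 : convexHull ℝ (S \ {toReal b}) ⊆ newton f \ {toReal b} :=
      convexHull_min (Set.sdiff_subset_sdiff_left (subset_convexHull ℝ S)) hconv
    exact (h2 h).2 rfl
  have hcl : IsClosed (convexHull ℝ (S \ {toReal b})) :=
    (hs.subset Set.sdiff_subset).isClosed_convexHull ℝ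
  obtain ⟨l, c, h1, h2⟩ := geometric_hahn_banach_point_closed (convex_convexHull ℝ _) hcl hnot
  refine ⟨l, fun a ha hab => h1.trans (h2 _ (subset_convexHull ℝ _ ⟨⟨a, ha, rfl⟩, ?_⟩))⟩
  intro h
  apply hab
  funext i
  have := congrFun (Set.mem_singleton_iff.1 h) i
  simpa [toReal] using this

theorem toReal_add (u v : Fin n → ℤ) : toReal (u + v) = toReal u + toReal v := by
  funext i; simp [toReal]

/-- Lower bounds for a linear functional on the support add up under products. -/
theorem bound_mul (l : (Fin n → ℝ) →L[ℝ] ℝ) {P Q : Laurent R n} {α β : ℝ}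
    (hP : ∀ e, P.coeff e ≠ 0 → α ≤ l (toReal e)) (hQ : ∀ e, Q.coeff e ≠ 0 → β ≤ l (toReal e)) :
    ∀ e, (P * Q).coeff e ≠ 0 → α + β ≤ l (toReal e) := by
  classical
  intro e he
  have h1 := AddMonoidAlgebra.support_coeff_mul_subset P Q (Finsupp.mem_support_iff.2 he)
  obtain ⟨a, ha, c, hc, rfl⟩ := Finset.mem_add.1 h1
  rw [toReal_add, map_add]
  exact add_le_add (hP a (Finsupp.mem_support_iff.1 ha)) (hQ c (Finsupp.mem_support_iff.1 hc))

theorem exists_bound (l : (Fin n → ℝ) →L[ℝ] ℝ) (s : Finset (Fin n → ℤ)) :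
    ∃ α : ℝ, ∀ e ∈ s, α ≤ l (toReal e) := by
  obtain ⟨α, hα⟩ := (s.image fun e => l (toReal e)).bddBelow
  exact ⟨α, fun e he => hα (Finset.mem_coe.2 (Finset.mem_image_of_mem _ he))⟩

/-- Only finitely many powers of `h` contribute to each coefficient. -/
theorem finite_contrib {f : Laurent R n} {b : Fin n → ℤ} (hv : IsVertex f b)
    (hu : IsUnit (f.coeff b)) (g : Laurent R n) (e : Fin n → ℤ) :
    {k : ℕ | (g * tail f b hu ^ k).coeff e ≠ 0}.Finite := by
  classical
  obtain ⟨l, hl⟩ := exists_functional hv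
  have hh : ∀ a, (tail f b hu).coeff a ≠ 0 → 0 < l (toReal a) := by
    intro a ha
    have h1 : (tail f b hu).coeff a =
        ((hu.unit⁻¹ : Rˣ) : R) * f.coeff (b + a) - (1 : Laurent R n).coeff a := by
      simp [tail]
    rw [h1] at ha
    have ha0 : a ≠ 0 := by
      rintro rfl
      apply ha
      simp [AddMonoidAlgebra.one_def]
    have h2 : (1 : Laurent R n).coeff a = 0 := by
      simp [AddMonoidAlgebra.one_def, ha0]
    have h3 : f.coeff (b + a) ≠ 0 := fun h => ha (by simp [h, h2])
    have h4 := hl _ h3 (by simpa using ha0)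
    rw [toReal_add, map_add] at h4
    linarith
  obtain ⟨ε, hε, hε'⟩ : ∃ ε : ℝ, 0 < ε ∧ ∀ a, (tail f b hu).coeff a ≠ 0 → ε ≤ l (toReal a) := by
    rcases (tail f b hu).coeff.support.eq_empty_or_nonempty with h0 | h0
    · exact ⟨1, one_pos, fun a ha => by
        have := Finsupp.mem_support_iff.2 ha
        simp [h0] at this⟩
    · obtain ⟨a, ha, hmin⟩ := Finset.exists_min_image _ (fun a => l (toReal a)) h0
      exact ⟨_, hh a (Finsupp.mem_support_iff.1 ha),
        fun c hc => hmin c (Finsupp.mem_support_iff.2 hc)⟩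
  obtain ⟨α, hα⟩ := exists_bound l g.coeff.support
  have key : ∀ k : ℕ, ∀ a, (g * tail f b hu ^ k).coeff a ≠ 0 → α + k * ε ≤ l (toReal a) := by
    intro k
    induction k with
    | zero => intro a ha; simpa using hα a (by simpa using ha)
    | succ k ih =>
      intro a ha
      rw [pow_succ, ← mul_assoc] at ha
      have := bound_mul l ih hε' a ha
      push_cast
      linarith
  obtain ⟨N, hN⟩ := exists_nat_gt ((l (toReal e) - α) / ε)
  refine (Set.finite_Iio N).subset fun k hk => ?_
  have h1 := key k e hk
  rw [div_lt_iff₀ hε] at hN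
  have h2 : (k : ℝ) * ε < N * ε := by linarith
  exact_mod_cast lt_of_mul_lt_mul_right h2 hε.le

theorem finite_terms {f : Laurent R n} {b : Fin n → ℤ} (hv : IsVertex f b)
    (hu : IsUnit (f.coeff b)) (c : ℕ → R) (g : Laurent R n) (e : Fin n → ℤ) :
    (Function.support fun k : ℕ => c k * (g * tail f b hu ^ k).coeff e).Finite :=
  (finite_contrib hv hu g e).subset fun _ hk h => hk (by simp [h])

theorem series_add {f : Laurent R n} {b : Fin n → ℤ} (hv : IsVertex f b)
    (hu : IsUnit (f.coeff b)) (g g' : Laurent R n) (m : ℕ) :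
    series f b hu (g + g') m = series f b hu g m + series f b hu g' m := by
  funext e
  simp only [series, Pi.add_apply]
  rw [← finsum_add_distrib (finite_terms hv hu _ _ e) (finite_terms hv hu _ _ e)]
  refine finsum_congr fun k => ?_
  rw [add_mul, add_mul, AddMonoidAlgebra.coeff_add, Finsupp.add_apply, mul_add]

theorem series_smul {f : Laurent R n} {b : Fin n → ℤ} (hv : IsVertex f b)
    (hu : IsUnit (f.coeff b)) (r : R) (g : Laurent R n) (m : ℕ) :
    series f b hu (r • g) m = r • series f b hu g m := by
  funext e
  simp only [series, Pi.smul_apply]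
  rw [smul_finsum' r (finite_terms hv hu _ _ e)]
  refine finsum_congr fun k => ?_
  rw [smul_mul_assoc, smul_mul_assoc, AddMonoidAlgebra.coeff_smul, Finsupp.smul_apply,
    smul_eq_mul, smul_eq_mul]
  ring

theorem series_mul {f : Laurent R n} {b : Fin n → ℤ} (hv : IsVertex f b)
    (hu : IsUnit (f.coeff b)) (g : Laurent R n) (m : ℕ) :
    series f b hu (g * f) (m + 1) = series f b hu g m := by
  funext e
  simp only [series]
  set M : Laurent R n := mono (-b) ((hu.unit⁻¹ : Rˣ) : R) with hM
  set h := tail f b hu with hh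
  have hf : M * f = 1 + h := by simp [hh, tail, hM]
  set G := g * M ^ m with hG
  have e1 : ∀ k, (g * f * M ^ (m + 1) * h ^ k) = G * h ^ k + G * h ^ (k + 1) := by
    intro k
    calc g * f * M ^ (m + 1) * h ^ k = G * (M * f) * h ^ k := by rw [hG]; ring
      _ = _ := by rw [hf]; ring
  simp only [e1, AddMonoidAlgebra.coeff_add, Finsupp.add_apply, mul_add]
  have fin1 : ∀ c : ℕ → R, (Function.support fun k : ℕ => c k * (G * h ^ k).coeff e).Finite :=
    fun c => finite_terms hv hu c G e
  have fin2 : ∀ c : ℕ → R,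
      (Function.support fun k : ℕ => c k * (G * h ^ (k + 1)).coeff e).Finite := by
    intro c
    have := finite_terms hv hu c (G * h) e
    simpa only [pow_succ', mul_assoc] using this
  obtain ⟨N, hN⟩ : ∃ N : ℕ, ∀ k, N ≤ k → (G * h ^ k).coeff e = 0 := by
    obtain ⟨N, hN⟩ := (finite_contrib hv hu G e).bddAbove
    refine ⟨N + 1, fun k hk => ?_⟩
    by_contra hne
    have := hN (Set.mem_ofPred.2 hne)
    omega
  have conv : ∀ F : ℕ → R, (∀ k, N ≤ k → F k = 0) → ∑ᶠ k, F k = ∑ k ∈ Finset.range (N + 1), F k := by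
    intro F hF
    refine finsum_eq_sum_of_support_subset _ fun k hk => ?_
    by_contra hne
    simp only [Finset.coe_range, Set.mem_Iio, not_lt] at hne
    exact hk (hF k (by omega))
  rw [conv _ (fun k hk => by rw [hN k hk, hN (k + 1) (by omega)]; ring),
    conv _ (fun k hk => by rw [hN k hk]; ring), Finset.sum_add_distrib,
    Finset.sum_range_succ' (fun k => (-1 : R) ^ k * _ * (G * h ^ k).coeff e),
    Finset.sum_range_succ (fun k => (-1 : R) ^ k * _ * (G * h ^ (k + 1)).coeff e),
    Finset.sum_range_succ' (fun k => (-1 : R) ^ k * (Nat.multichoose m k : R) * _),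
    hN (N + 1) (by omega)]
  have : ∀ k, (-1 : R) ^ (k + 1) * (Nat.multichoose m (k + 1) : R) * (G * h ^ (k + 1)).coeff e =
      (-1 : R) ^ (k + 1) * (Nat.multichoose (m + 1) (k + 1) : R) * (G * h ^ (k + 1)).coeff e +
      (-1 : R) ^ k * (Nat.multichoose (m + 1) k : R) * (G * h ^ (k + 1)).coeff e := by
    intro k
    rw [Nat.multichoose_succ_succ]
    push_cast
    ring
  simp only [this, Finset.sum_add_distrib, Nat.multichoose_zero_right]
  ring

theorem series_mul_pow {f : Laurent R n} {b : Fin n → ℤ} (hv : IsVertex f b)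
    (hu : IsUnit (f.coeff b)) (g : Laurent R n) (m j : ℕ) :
    series f b hu (f ^ j * g) (m + j) = series f b hu g m := by
  induction j with
  | zero => simp
  | succ j ih =>
    rw [← ih, ← series_mul hv hu (f ^ j * g) (m + j), ← add_assoc]
    congr 1
    ring

theorem series_congr {f : Laurent R n} {b : Fin n → ℤ} (hv : IsVertex f b)
    (hu : IsUnit (f.coeff b)) {r : RegFun f} {g g' : Laurent R n} {m m' : ℕ}
    (h : r * algebraMap (Laurent R n) (RegFun f) (f ^ m) = algebraMap _ _ g)
    (h' : r * algebraMap (Laurent R n) (RegFun f) (f ^ m') = algebraMap _ _ g') :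
    series f b hu g m = series f b hu g' m' := by
  have h1 : algebraMap (Laurent R n) (RegFun f) (f ^ m' * g) = algebraMap _ _ (f ^ m * g') := by
    rw [map_mul, map_mul, ← h, ← h']; ring
  obtain ⟨c, hc⟩ := IsLocalization.Away.exists_of_eq f h1
  rw [← series_mul_pow hv hu g m (c + m'), ← series_mul_pow hv hu g' m' (c + m), pow_add, pow_add,
    mul_assoc, mul_assoc, hc]
  congr 1
  ring

/-- Formal expansion at the vertex `b`: the rational function `g / f^m` is sent to the family of
coefficients of its Laurent series. -/
def expand (f : Laurent R n) (b : Fin n → ℤ) (hv : IsVertex f b) (hu : IsUnit (f.coeff b)) :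
    RegFun f →ₗ[R] ((Fin n → ℤ) → R) where
  toFun r := series f b hu (IsLocalization.Away.sec f r).1 (IsLocalization.Away.sec f r).2
  map_add' r s := by
    rw [← series_mul_pow hv hu (IsLocalization.Away.sec f r).1 _ (IsLocalization.Away.sec f s).2,
      ← series_mul_pow hv hu (IsLocalization.Away.sec f s).1 _ (IsLocalization.Away.sec f r).2,
      add_comm (IsLocalization.Away.sec f s).2, ← series_add hv hu]
    refine series_congr hv hu (IsLocalization.Away.sec_spec f (r + s)) ?_
    rw [map_add, map_mul, map_mul, ← IsLocalization.Away.sec_spec f r,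
      ← IsLocalization.Away.sec_spec f s, pow_add, map_mul]
    ring
  map_smul' c r := by
    rw [RingHom.id_apply, ← series_smul hv hu]
    refine series_congr hv hu (IsLocalization.Away.sec_spec f (c • r)) ?_
    rw [smul_mul_assoc, IsLocalization.Away.sec_spec f r]
    simp only [Algebra.smul_def, map_mul]
    rw [← IsScalarTower.algebraMap_apply R (Laurent R n) (RegFun f)]

/-- The formal expansion does what it should on a fraction `r = g / f^m`. -/
theorem expand_eq (f : Laurent R n) (b : Fin n → ℤ) (hv : IsVertex f b) (hu : IsUnit (f.coeff b))
    {r : RegFun f} {g : Laurent R n} {m : ℕ}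
    (h : r * algebraMap (Laurent R n) (RegFun f) (f ^ m) = algebraMap _ _ g) :
    expand f b hv hu r = series f b hu g m :=
  series_congr hv hu (IsLocalization.Away.sec_spec f r) h

/-! ### Formal series and formal derivatives -/

/-- The module `Ω_formal` of formal Laurent series (families of coefficients) supported in the cone
`C(Δ - b) = {λ (v - b) | v ∈ Δ, λ ≥ 0}`. -/
def OmegaFormal (f : Laurent R n) (b : Fin n → ℤ) : Submodule R ((Fin n → ℤ) → R) where
  carrier := {a | ∀ k, a k ≠ 0 →
    ∃ c : ℝ, 0 ≤ c ∧ ∃ v ∈ newton f, toReal k = c • (v - toReal b)}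
  zero_mem' := fun _ hk => absurd rfl hk
  add_mem' := by
    intro a a' ha ha' k hk
    by_cases h : a k = 0
    · exact ha' k fun h' => hk (by simp [h, h'])
    · exact ha k h
  smul_mem' := by
    intro r a ha k hk
    exact ha k fun h => hk (by simp [h])

/-- The derivation `θ_i = x_i ∂/∂x_i` on formal series. -/
def theta (i : Fin n) : ((Fin n → ℤ) → R) →ₗ[R] ((Fin n → ℤ) → R) where
  toFun a := fun k => (k i : R) * a k
  map_add' a a' := by funext k; simp [mul_add]
  map_smul' r a := by funext k; simp; ring

/-- The module `dΩ_formal` of formal derivatives: the span of the `θ_i a` with `a ∈ Ω_formal`. -/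
def dOmegaFormal (f : Laurent R n) (b : Fin n → ℤ) : Submodule R ((Fin n → ℤ) → R) :=
  Submodule.span R {a | ∃ i : Fin n, ∃ a' ∈ OmegaFormal f b, a = theta i a'}

/-! ### The completed modules -/

/-- The ideal `pR`. -/
abbrev pIdeal (R : Type*) [CommRing R] (p : ℕ) : Ideal R := Ideal.span {(p : R)}

/-- The `p`-adic completion `lim_s Ω_f(μ) / p^s Ω_f(μ)`. -/
abbrev OmegaHat (p : ℕ) {f : Laurent R n} (μ : FaceOpen f) : Type _ :=
  AdicCompletion (pIdeal R p) (Omega μ)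

/-- The formal expansion on the completion: each coefficient extends by continuity, as `R` is
`p`-adically complete. -/
def expandHat (p : ℕ) [IsAdicComplete (pIdeal R p) R] (f : Laurent R n) (b : Fin n → ℤ)
    (hv : IsVertex f b) (hu : IsUnit (f.coeff b)) (μ : FaceOpen f) :
    OmegaHat p μ →ₗ[R] ((Fin n → ℤ) → R) :=
  LinearMap.pi fun k =>
    (AdicCompletion.ofLinearEquiv (pIdeal R p) R).symm.toLinearMap ∘ₗ
      (AdicCompletion.map (pIdeal R p)
        (LinearMap.proj k ∘ₗ expand f b hv hu ∘ₗ (Omega μ).subtype)).restrictScalars R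

theorem expandHat_of (p : ℕ) [IsAdicComplete (pIdeal R p) R] (f : Laurent R n) (b : Fin n → ℤ)
    (hv : IsVertex f b) (hu : IsUnit (f.coeff b)) (μ : FaceOpen f) (r : Omega μ) :
    expandHat p f b hv hu μ (AdicCompletion.of _ _ r) = expand f b hv hu r := by
  funext k
  simp only [expandHat, LinearMap.pi_apply, LinearMap.comp_apply, LinearMap.restrictScalars_apply,
    AdicCompletion.map_of, LinearEquiv.coe_coe]
  exact AdicCompletion.ofLinearEquiv_symm_of _ _

/-- The submodule `U_f(μ)` of elements of the completion whose formal expansion is a formal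
derivative. -/
def U (p : ℕ) [IsAdicComplete (pIdeal R p) R] (f : Laurent R n) (b : Fin n → ℤ)
    (hv : IsVertex f b) (hu : IsUnit (f.coeff b)) (μ : FaceOpen f) : Submodule R (OmegaHat p μ) :=
  (dOmegaFormal f b).comap (expandHat p f b hv hu μ)

/-- The quotient `Q_f(μ)` of the completion by the formal derivatives. -/
abbrev Q (p : ℕ) [IsAdicComplete (pIdeal R p) R] (f : Laurent R n) (b : Fin n → ℤ)
    (hv : IsVertex f b) (hu : IsUnit (f.coeff b)) (μ : FaceOpen f) : Type _ :=
  OmegaHat p μ ⧸ U p f b hv hu μ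

/-- The image of `ω_u = x^u / f` in `Q_f(μ)`, for `u ∈ μ_ℤ`. -/
def omegaClass (p : ℕ) [IsAdicComplete (pIdeal R p) R] (f : Laurent R n) (b : Fin n → ℤ)
    (hv : IsVertex f b) (hu : IsUnit (f.coeff b)) (μ : FaceOpen f) (u : μ.lattice) :
    Q p f b hv hu μ :=
  (U p f b hv hu μ).mkQ (AdicCompletion.of (pIdeal R p) (Omega μ) ⟨omega f 1 u, omega_mem μ u⟩)

end UnitRootCrystal

end

open UnitRootCrystal

/-! Everything is tested on formal expansions. Let C be the Cartier operator, which sends the family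
(a_k) to (a_{pk}). A formal series is a formal derivative exactly when p^s divides C^s a for every s
(`mem_dOmegaFormal_iff`), so U_f(μ) is cut out by the conditions in `divisibleUpTo`.

The second ingredient is the action of C on expansions. Since f^σ(x^p) = f^p + pG, one can expand
f^{-m} = f^t (f^σ(x^p) - pG)^{-k}, with m + t = pk, in powers of pG. Pulling f^σ(x^p) out of C turns
each term into a function with a power of f^σ as its denominator. The factorials in ω_{(k,u)} are
what makes the r-th term, r ≥ 1, divisible by p: p^r / r! is. For the smallest possible k, the
leading term also is, unless k = 1. Thus C sends expansions for f into the span of the ω_v for f^σ,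
plus p times expansions for f^σ, and on ω_u the coefficients modulo p are the Hasse–Witt matrix
(`cartier_generator`, `cartier_generator_mem`, `cartier_lattice`). As C changes f into f^σ, all
conjugates f^{σ^j} are treated together.

The rest is linear algebra. Because the matrices are invertible, induction on s shows that each
expansion is congruent to a combination of the ω_u modulo the families satisfying the divisibility
conditions up to s (`exists_coeff_divisibleUpTo`), and that its coefficients are unique modulo p^s
(`coeff_mem_of_divisibleUpTo`). Letting s tend to infinity, uniqueness gives linear independence,
makes the coefficients a Cauchy sequence, and so gives generation.

No completion of the modules of expansions is needed: identities hold up to p^N times an arbitrary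
family, for each N. -/

noncomputable section

namespace UnitRootCrystal

/-! ### Abstract iteration of an operator with invertible matrix modulo π. -/

section Iteration

variable {R : Type*} [CommRing R] {F : Type*} [AddCommGroup F] [Module R F]

/-- The elements `a` with `C ^ t a` divisible by `π ^ t` for all `t ≤ s`. -/
def divisibleUpTo (π : R) (C : Module.End R F) (s : ℕ) : Submodule R F where
  carrier := {a | ∀ t ≤ s, ∃ y, (C ^ t) a = π ^ t • y}
  zero_mem' := fun t _ => ⟨0, by simp⟩
  add_mem' := by
    intro a b ha hb t ht
    obtain ⟨x, hx⟩ := ha t ht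
    obtain ⟨y, hy⟩ := hb t ht
    exact ⟨x + y, by rw [map_add, hx, hy, smul_add]⟩
  smul_mem' := by
    intro r a ha t ht
    obtain ⟨x, hx⟩ := ha t ht
    exact ⟨r • x, by rw [map_smul, hx, smul_comm]⟩

/-- The induction step for both main lemmas: if one application of C produces a factor π, it raises
the level by one. -/
theorem mem_divisibleUpTo_succ {π : R} {C : Module.End R F} {s : ℕ} {a d : F}
    (h : C a = π • d) (hd : d ∈ divisibleUpTo π C s) : a ∈ divisibleUpTo π C (s + 1) := by
  intro t ht
  cases t with
  | zero => exact ⟨a, by simp⟩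
  | succ t =>
    obtain ⟨y, hy⟩ := hd t (by omega)
    exact ⟨y, by rw [pow_succ, Module.End.mul_apply, h, map_smul, hy, smul_smul, ← pow_succ']⟩

theorem isUnit_of_sub_mem {π x y : R} (hπ : π ∈ (⊥ : Ideal R).jacobson) (hx : IsUnit x)
    (h : y - x ∈ Ideal.span {π}) : IsUnit y := by
  obtain ⟨u, rfl⟩ := hx
  obtain ⟨r, hr⟩ := Ideal.mem_span_singleton'.1 h
  have h1 := Ideal.mem_jacobson_bot.1 hπ (r * (u⁻¹ : Rˣ))
  have h2 : y = (π * (r * (u⁻¹ : Rˣ)) + 1) * u := by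
    calc y = r * π + u := by rw [hr]; ring
      _ = π * r * ((u⁻¹ : Rˣ) * u) + u := by rw [Units.inv_mul]; ring
      _ = _ := by ring
  rw [h2]
  exact h1.mul u.isUnit

/-- The determinants agree modulo π, and π lies in the Jacobson radical. This lets the Hasse–Witt
matrix be replaced by the exact matrix of C. -/
theorem isUnit_matrix_of_sub_mem {ι : Type*} [Fintype ι] [DecidableEq ι] {π : R}
    (hπ : π ∈ (⊥ : Ideal R).jacobson) {A B : Matrix ι ι R} (hA : IsUnit A)
    (h : ∀ u v, B u v - A u v ∈ Ideal.span {π}) : IsUnit B := by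
  rw [Matrix.isUnit_iff_isUnit_det] at hA ⊢
  refine isUnit_of_sub_mem hπ hA ?_
  rw [← Ideal.Quotient.eq, RingHom.map_det, RingHom.map_det]
  congr 1
  ext u v
  exact Ideal.Quotient.eq.2 (h u v)

variable {ι : Type*} [Fintype ι] {π : R} {C : Module.End R F} {A : ℕ → Submodule R F}
  {e : ℕ → ι → F} {β : ℕ → Matrix ι ι R}

theorem sum_smul_sum_vecMul (c : ι → R) (B : Matrix ι ι R) (e : ι → F) :
    ∑ u, c u • ∑ v, B u v • e v = ∑ v, (Matrix.vecMul c B) v • e v := by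
  simp only [Finset.smul_sum, smul_smul, Matrix.vecMul, dotProduct, Finset.sum_smul]
  exact Finset.sum_comm

/-- If the coefficients exist for elements of `A (j + 1)` up to `s`, then `C` acts on the `e j u`
through a matrix that is congruent to `β j`, up to a multiple of an element of
`divisibleUpTo π C s`. -/
theorem exists_matrix
    (H : ∀ j s u, ∃ a ∈ A (j + 1), ∃ x, C (e j u) = ∑ v, β j u v • e (j + 1) v + π • a + π ^ s • x)
    {s : ℕ} (hs : ∀ j, ∀ a ∈ A j, ∀ x, ∃ c : ι → R,
      a + π ^ s • x - ∑ u, c u • e j u ∈ divisibleUpTo π C s) (j : ℕ) :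
    ∃ B : Matrix ι ι R, ∃ d : ι → F, (∀ u v, B u v - β j u v ∈ Ideal.span {π}) ∧
      (∀ u, d u ∈ divisibleUpTo π C s) ∧
      ∀ u, C (e j u) = ∑ v, B u v • e (j + 1) v + π • d u := by
  have key : ∀ u, ∃ c : ι → R, ∃ d ∈ divisibleUpTo π C s,
      C (e j u) = ∑ v, (β j u v + π * c v) • e (j + 1) v + π • d := by
    intro u
    -- Precision s + 1 makes the error π · (π ^ s • x), which joins `a` inside the factor π, in the
    -- shape required by `hs`.
    obtain ⟨a, ha, x, hx⟩ := H j (s + 1) u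
    obtain ⟨c, hc⟩ := hs _ a ha x
    refine ⟨c, _, hc, ?_⟩
    simp only [hx, add_smul, Finset.sum_add_distrib, mul_smul, ← Finset.smul_sum, smul_sub,
      smul_add, smul_smul π (π ^ s), ← pow_succ']
    abel
  choose c d hd h using key
  exact ⟨fun u v => β j u v + π * c u v, d,
    fun u v => Ideal.mem_span_singleton.2 ⟨c u v, by ring⟩, hd, h⟩

variable [DecidableEq ι]

/-- Up to level s, C(a) = c₁·e + π(c₂·e) + π(remainder), where c₂ comes from the induction
hypothesis at j + 1. Solving cB = c₁ + πc₂ makes C(a - c·e) equal to π times an element of level s.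
The term π ^ s • x is carried along because C leaves `A` by such errors. -/
theorem exists_coeff_divisibleUpTo (hπ : π ∈ (⊥ : Ideal R).jacobson) (hβ : ∀ j, IsUnit (β j))
    (hC : ∀ j s, ∀ a ∈ A j, ∃ c : ι → R, ∃ a' ∈ A (j + 1), ∃ x,
      C a = ∑ u, c u • e (j + 1) u + π • a' + π ^ s • x)
    (H : ∀ j s u, ∃ a ∈ A (j + 1), ∃ x, C (e j u) = ∑ v, β j u v • e (j + 1) v + π • a + π ^ s • x)
    (s : ℕ) : ∀ j, ∀ a ∈ A j, ∀ x, ∃ c : ι → R,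
      a + π ^ s • x - ∑ u, c u • e j u ∈ divisibleUpTo π C s := by
  induction s with
  | zero =>
    intro j a _ x
    refine ⟨0, fun t ht => ?_⟩
    obtain rfl : t = 0 := by omega
    exact ⟨_, ((congrArg (· • _) (pow_zero π)).trans (one_smul R _)).symm⟩
  | succ s ih =>
    intro j a ha x
    obtain ⟨B, d, hB, hd, hBd⟩ := exists_matrix H ih j
    have hBu : IsUnit B := isUnit_matrix_of_sub_mem hπ (hβ j) hB
    obtain ⟨c₁, a', ha', x', h1⟩ := hC j (s + 1) a ha
    obtain ⟨c₂, h2⟩ := ih (j + 1) a' ha' (x' + C x)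
    set c : ι → R := Matrix.vecMul (c₁ + π • c₂) B⁻¹ with hc
    have hcB : Matrix.vecMul c B = c₁ + π • c₂ := by
      rw [hc, Matrix.vecMul_vecMul, Matrix.nonsing_inv_mul _ ((Matrix.isUnit_iff_isUnit_det _).1 hBu),
        Matrix.vecMul_one]
    refine ⟨c, mem_divisibleUpTo_succ (d := (a' + π ^ s • (x' + C x) - ∑ u, c₂ u • e (j + 1) u) -
      ∑ u, c u • d u) ?_ (Submodule.sub_mem _ h2 (Submodule.sum_mem _ fun u _ =>
        Submodule.smul_mem _ _ (hd u)))⟩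
    have h3 : C (∑ u, c u • e j u) =
        ∑ u, c₁ u • e (j + 1) u + π • ∑ u, c₂ u • e (j + 1) u + π • ∑ u, c u • d u := by
      simp only [map_sum, map_smul, hBd, smul_add, Finset.sum_add_distrib, sum_smul_sum_vecMul, hcB,
        Pi.add_apply, Pi.smul_apply, add_smul, smul_eq_mul, mul_smul, ← Finset.smul_sum,
        smul_comm _ π]
    rw [map_sub, map_add, h1, h3, map_smul]
    simp only [smul_sub, smul_add, smul_smul π (π ^ s), ← pow_succ']
    abel

/-- Applying C replaces c by cB, up to π times an element of level s. Independence modulo π gives cB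
= πc'; after cancelling π, the induction hypothesis applies to c' at j + 1, and inverting B returns
to c. -/
theorem coeff_mem_of_divisibleUpTo (hπ : π ∈ (⊥ : Ideal R).jacobson) (hβ : ∀ j, IsUnit (β j))
    (hC : ∀ j s, ∀ a ∈ A j, ∃ c : ι → R, ∃ a' ∈ A (j + 1), ∃ x,
      C a = ∑ u, c u • e (j + 1) u + π • a' + π ^ s • x)
    (H : ∀ j s u, ∃ a ∈ A (j + 1), ∃ x, C (e j u) = ∑ v, β j u v • e (j + 1) v + π • a + π ^ s • x)
    (hF : ∀ x y : F, π • x = π • y → x = y)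
    (hind : ∀ j (c : ι → R) x, ∑ u, c u • e j u = π • x → ∀ u, π ∣ c u)
    (s : ℕ) : ∀ j (c : ι → R), ∑ u, c u • e j u ∈ divisibleUpTo π C s → ∀ u, π ^ s ∣ c u := by
  induction s with
  | zero => intro j c _ u; simp
  | succ s ih =>
    intro j c hc
    obtain ⟨B, d, hB, hd, hBd⟩ := exists_matrix H (exists_coeff_divisibleUpTo hπ hβ hC H s) j
    have hBu : IsUnit B := isUnit_matrix_of_sub_mem hπ (hβ j) hB
    have h3 : C (∑ u, c u • e j u) =
        ∑ u, (Matrix.vecMul c B) u • e (j + 1) u + π • ∑ u, c u • d u := by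
      simp only [map_sum, map_smul, hBd, smul_add, Finset.sum_add_distrib, sum_smul_sum_vecMul,
        ← Finset.smul_sum, smul_comm _ π]
    have hd' : ∑ u, c u • d u ∈ divisibleUpTo π C s :=
      Submodule.sum_mem _ fun u _ => Submodule.smul_mem _ _ (hd u)
    have h4 : ∀ t ≤ s, ∃ y, (C ^ t) (∑ u, (Matrix.vecMul c B) u • e (j + 1) u) = π ^ (t + 1) • y := by
      intro t ht
      obtain ⟨y, hy⟩ := hc (t + 1) (by omega)
      obtain ⟨z, hz⟩ := hd' t ht
      refine ⟨y - z, ?_⟩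
      rw [pow_succ C, Module.End.mul_apply, h3, map_add, map_smul, hz, smul_smul, ← pow_succ'] at hy
      rw [smul_sub, ← hy, add_sub_cancel_right]
    obtain ⟨y, hy⟩ := h4 0 (by omega)
    have h5 := hind _ _ y (by simpa using hy)
    choose c' hc' using h5
    have h6 : ∀ u, π ^ s ∣ c' u := by
      refine ih (j + 1) c' fun t ht => ?_
      obtain ⟨y, hy⟩ := h4 t ht
      refine ⟨y, hF _ _ ?_⟩
      rw [smul_smul, ← pow_succ', ← hy, ← map_smul, Finset.smul_sum]
      simp only [smul_smul, hc']
    have h7 : c = Matrix.vecMul (Matrix.vecMul c B) B⁻¹ := by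
      rw [Matrix.vecMul_vecMul, Matrix.mul_nonsing_inv _ ((Matrix.isUnit_iff_isUnit_det _).1 hBu),
        Matrix.vecMul_one]
    intro u
    rw [h7]
    refine Finset.dvd_sum fun v _ => Dvd.dvd.mul_right ?_ _
    rw [hc', pow_succ']
    exact mul_dvd_mul_left _ (h6 v)

end Iteration

/-! ### Convolution by Laurent polynomials, and the Cartier operator. -/

section Action

variable {R : Type*} [CommRing R] {n : ℕ}

/-- Translation of families of coefficients, as a representation of `ℤ^n`. -/
def translate (R : Type*) [CommRing R] (n : ℕ) :
    Multiplicative (Fin n → ℤ) →* Module.End R ((Fin n → ℤ) → R) where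
  toFun u := LinearMap.funLeft R R fun e => e - u.toAdd
  map_one' := by ext; simp [LinearMap.funLeft]
  map_mul' u v := by
    refine LinearMap.ext fun a => funext fun e => ?_
    simp [LinearMap.funLeft, sub_sub]

/-- The action of Laurent polynomials on families of coefficients by convolution. -/
def act : Laurent R n →ₐ[R] Module.End R ((Fin n → ℤ) → R) :=
  AddMonoidAlgebra.lift R _ _ (translate R n)

theorem act_mono (u : Fin n → ℤ) (c : R) (a : (Fin n → ℤ) → R) (e : Fin n → ℤ) :
    act (mono u c) a e = c * a (e - u) := by
  simp [act, translate, LinearMap.funLeft]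

theorem act_apply (g : Laurent R n) (a : (Fin n → ℤ) → R) (e : Fin n → ℤ) :
    act g a e = ∑ u ∈ g.coeff.support, g.coeff u * a (e - u) := by
  simp [act, AddMonoidAlgebra.lift_apply, Finsupp.sum, translate, LinearMap.funLeft,
    LinearMap.sum_apply]

theorem act_mul (g g' : Laurent R n) (a : (Fin n → ℤ) → R) : act (g * g') a = act g (act g' a) := by
  rw [map_mul, Module.End.mul_apply]

theorem act_coeff (g g' : Laurent R n) : act g (⇑g'.coeff) = ⇑(g * g').coeff := by
  induction g using AddMonoidAlgebra.induction_linear with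
  | zero => simp
  | add x y hx hy => rw [map_add, LinearMap.add_apply, hx, hy, add_mul]; rfl
  | single u c =>
    funext e
    rw [act_mono, ← AddMonoidAlgebra.coeff_single_mul_eq_mul_coeff]
    intro m _
    rw [eq_sub_iff_add_eq, add_comm]

/-- The family of coefficients is bounded below with respect to the functional `l`. -/
def BoundedBelow (l : (Fin n → ℝ) →L[ℝ] ℝ) (a : (Fin n → ℤ) → R) : Prop :=
  ∃ α : ℝ, ∀ e, a e ≠ 0 → α ≤ l (toReal e)

theorem BoundedBelow.sub {l : (Fin n → ℝ) →L[ℝ] ℝ} {a a' : (Fin n → ℤ) → R}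
    (h : BoundedBelow l a) (h' : BoundedBelow l a') : BoundedBelow l (a - a') := by
  obtain ⟨α, hα⟩ := h
  obtain ⟨α', hα'⟩ := h'
  refine ⟨min α α', fun e he => ?_⟩
  by_cases h : a e = 0
  · exact (min_le_right _ _).trans (hα' e fun h' => he (by simp [h, h']))
  · exact (min_le_left _ _).trans (hα e h)

theorem BoundedBelow.zero (l : (Fin n → ℝ) →L[ℝ] ℝ) :
    BoundedBelow l (0 : (Fin n → ℤ) → R) := ⟨0, fun _ h => absurd rfl h⟩

theorem BoundedBelow.add {l : (Fin n → ℝ) →L[ℝ] ℝ} {a a' : (Fin n → ℤ) → R}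
    (h : BoundedBelow l a) (h' : BoundedBelow l a') : BoundedBelow l (a + a') := by
  have : a + a' = a - (0 - a') := by abel
  rw [this]
  exact h.sub ((BoundedBelow.zero l).sub h')

theorem BoundedBelow.smul {l : (Fin n → ℝ) →L[ℝ] ℝ} {a : (Fin n → ℤ) → R}
    (h : BoundedBelow l a) (r : R) : BoundedBelow l (r • a) := by
  obtain ⟨α, hα⟩ := h
  exact ⟨α, fun e he => hα e fun h => he (by simp [h])⟩

theorem BoundedBelow.sum {l : (Fin n → ℝ) →L[ℝ] ℝ} {κ : Type*} {s : Finset κ}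
    {a : κ → (Fin n → ℤ) → R} (h : ∀ i ∈ s, BoundedBelow l (a i)) :
    BoundedBelow l (∑ i ∈ s, a i) := by
  classical
  induction s using Finset.induction_on with
  | empty => simpa using BoundedBelow.zero l
  | insert i s hi ih =>
    rw [Finset.sum_insert hi]
    exact (h i (by simp)).add (ih fun j hj => h j (by simp [hj]))

theorem toReal_sub (u v : Fin n → ℤ) : toReal (u - v) = toReal u - toReal v := by
  funext i; simp [toReal]

theorem toReal_nsmul (k : ℕ) (u : Fin n → ℤ) : toReal (k • u) = (k : ℝ) • toReal u := by
  funext i; simp [toReal]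

theorem BoundedBelow.act {l : (Fin n → ℝ) →L[ℝ] ℝ} {a : (Fin n → ℤ) → R}
    (h : BoundedBelow l a) (g : Laurent R n) : BoundedBelow l (act g a) := by
  obtain ⟨α, hα⟩ := h
  obtain ⟨γ, hγ⟩ := exists_bound l g.coeff.support
  refine ⟨α + γ, fun e he => ?_⟩
  rw [act_apply] at he
  obtain ⟨u, hu, hne⟩ := Finset.exists_ne_zero_of_sum_ne_zero he
  have h1 := hα (e - u) fun h => hne (by simp [h])
  have h2 := hγ u hu
  rw [toReal_sub, map_sub] at h1
  linarith

/-- A Laurent polynomial whose lowest term with respect to `l` is `x^b`, with a unit as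
coefficient. -/
structure LowestTerm (l : (Fin n → ℝ) →L[ℝ] ℝ) (g : Laurent R n) (b : Fin n → ℤ) : Prop where
  isUnit : IsUnit (g.coeff b)
  lt : ∀ a, g.coeff a ≠ 0 → a ≠ b → l (toReal b) < l (toReal a)

/-- Convolution with a Laurent polynomial that has a lowest term is injective on bounded below
families, modulo every ideal. -/
theorem LowestTerm.mem_of_act_mem {l : (Fin n → ℝ) →L[ℝ] ℝ} {g : Laurent R n} {b : Fin n → ℤ}
    (hg : LowestTerm l g b) (I : Ideal R) {a : (Fin n → ℤ) → R} (ha : BoundedBelow l a)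
    (h : ∀ e, act g a e ∈ I) (e : Fin n → ℤ) : a e ∈ I := by
  classical
  nontriviality R
  obtain ⟨α, hα⟩ := ha
  obtain ⟨ε, hε, hε'⟩ : ∃ ε : ℝ, 0 < ε ∧
      ∀ c ∈ g.coeff.support.erase b, l (toReal b) + ε ≤ l (toReal c) := by
    rcases (g.coeff.support.erase b).eq_empty_or_nonempty with h0 | h0
    · exact ⟨1, one_pos, by simp [h0]⟩
    · obtain ⟨c, hc, hmin⟩ := Finset.exists_min_image _ (fun a => l (toReal a)) h0
      have := hg.lt c (by simpa using (Finset.mem_erase.1 hc).2) (Finset.mem_erase.1 hc).1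
      exact ⟨l (toReal c) - l (toReal b), by linarith, fun c' hc' => by
        linarith [hmin c' hc']⟩
  -- Induction over levels of width ε: in the coefficient of g·a at e + b, the lowest term
  -- contributes a unit times a_e, and the others involve a only at points where l is lower by at
  -- least ε.
  have key : ∀ N : ℕ, ∀ e, l (toReal e) < α + N * ε → a e ∈ I := by
    intro N
    induction N with
    | zero =>
      intro e he
      by_cases h0 : a e = 0
      · simp [h0]
      · have := hα e h0
        simp at he
        linarith
    | succ N ih =>
      intro e he
      have h1 := h (e + b)
      rw [act_apply, ← Finset.add_sum_erase _ _ (a := b), add_sub_cancel_right] at h1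
      · have h2 : ∑ u ∈ g.coeff.support.erase b, g.coeff u * a (e + b - u) ∈ I := by
          refine Ideal.sum_mem _ fun u hu => Ideal.mul_mem_left _ _ (ih _ ?_)
          have := hε' u hu
          rw [toReal_sub, toReal_add, map_sub, map_add]
          push_cast at he
          linarith
        have h3 := (Ideal.add_mem_iff_left _ h2).1 h1
        exact (Ideal.unit_mul_mem_iff_mem I hg.isUnit).1 h3
      · exact Finsupp.mem_support_iff.2 hg.isUnit.ne_zero
  obtain ⟨N, hN⟩ := exists_nat_gt ((l (toReal e) - α) / ε)
  rw [div_lt_iff₀ hε] at hN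
  exact key N e (by linarith)

variable (p : ℕ)

/-- The Cartier operator `∑ a_k x^k ↦ ∑ a_{pk} x^k`. -/
def cartier : Module.End R ((Fin n → ℤ) → R) := LinearMap.funLeft R R fun e => p • e

theorem cartier_apply (a : (Fin n → ℤ) → R) (e : Fin n → ℤ) : cartier p a e = a (p • e) := rfl

theorem cartier_pow_apply (s : ℕ) (a : (Fin n → ℤ) → R) (e : Fin n → ℤ) :
    (cartier p ^ s) a e = a (p ^ s • e) := by
  induction s generalizing e with
  | zero => simp
  | succ s ih => rw [pow_succ', Module.End.mul_apply, cartier_apply, ih, smul_smul, pow_succ]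

/-- The substitution `∑ a_k x^k ↦ ∑ a_k x^{pk}`. -/
def verschiebung (a : (Fin n → ℤ) → R) : (Fin n → ℤ) → R :=
  Function.extend (fun e : Fin n → ℤ => p • e) a 0

/-- The substitution `x ↦ x^p` on Laurent polynomials. -/
def substPow : Laurent R n →+* Laurent R n :=
  AddMonoidAlgebra.mapDomainRingHom R (nsmulAddMonoidHom p)

theorem substPow_mono (u : Fin n → ℤ) (c : R) : substPow p (mono u c) = mono (p • u) c := by
  simp [substPow]

variable {p}

theorem nsmul_injective_of_pos (hp : 0 < p) : Function.Injective fun e : Fin n → ℤ => p • e := by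
  intro u v h
  funext i
  have := congrFun h i
  simp only [Pi.smul_apply, nsmul_eq_mul] at this
  exact mul_left_cancel₀ (by exact_mod_cast hp.ne') this

theorem verschiebung_nsmul (hp : 0 < p) (a : (Fin n → ℤ) → R) (e : Fin n → ℤ) :
    verschiebung p a (p • e) = a e :=
  (nsmul_injective_of_pos hp).extend_apply a 0 e

theorem verschiebung_of_notMem (a : (Fin n → ℤ) → R) {e : Fin n → ℤ} (h : ∀ w, p • w ≠ e) :
    verschiebung p a e = 0 :=
  Function.extend_apply' _ _ _ fun ⟨w, hw⟩ => h w hw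

theorem verschiebung_add (hp : 0 < p) (a a' : (Fin n → ℤ) → R) :
    verschiebung p (a + a') = verschiebung p a + verschiebung p a' := by
  funext e
  by_cases h : ∃ w, p • w = e
  · obtain ⟨w, rfl⟩ := h
    simp only [Pi.add_apply, verschiebung_nsmul hp]
  · have h' := not_exists.1 h
    simp [verschiebung_of_notMem _ h']

theorem verschiebung_zero (hp : 0 < p) :
    verschiebung p (0 : (Fin n → ℤ) → R) = 0 := by
  simpa using verschiebung_add (R := R) (n := n) hp 0 0

theorem verschiebung_act (hp : 0 < p) (g : Laurent R n) (a : (Fin n → ℤ) → R) :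
    verschiebung p (act g a) = act (substPow p g) (verschiebung p a) := by
  induction g using AddMonoidAlgebra.induction_linear with
  | zero => simp [verschiebung_zero hp]
  | add x y hx hy => simp [verschiebung_add hp, hx, hy]
  | single u c =>
    funext e
    rw [substPow_mono, act_mono]
    by_cases h : ∃ w, p • w = e
    · obtain ⟨w, rfl⟩ := h
      rw [verschiebung_nsmul hp, act_mono, ← smul_sub, verschiebung_nsmul hp]
    · rw [verschiebung_of_notMem _ (not_exists.1 h), verschiebung_of_notMem, mul_zero]
      intro w hw
      exact h ⟨w + u, by rw [smul_add, hw, sub_add_cancel]⟩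

theorem verschiebung_one (hp : 0 < p) :
    verschiebung p (⇑(1 : Laurent R n).coeff) = ⇑(1 : Laurent R n).coeff := by
  funext e
  by_cases h : ∃ w, p • w = e
  · obtain ⟨w, rfl⟩ := h
    rw [verschiebung_nsmul hp]
    simp only [AddMonoidAlgebra.one_def, AddMonoidAlgebra.coeff_single, Finsupp.single_apply]
    congr 1
    refine propext ⟨fun h => by simp [← h], fun h => ?_⟩
    exact nsmul_injective_of_pos hp (by simpa using h)
  · have h0 : e ≠ 0 := fun h0 => h ⟨0, by simp [h0]⟩
    rw [verschiebung_of_notMem _ (not_exists.1 h)]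
    simp [AddMonoidAlgebra.one_def, h0]

theorem BoundedBelow.verschiebung {l : (Fin n → ℝ) →L[ℝ] ℝ} {a : (Fin n → ℤ) → R}
    (h : BoundedBelow l a) (hp : 0 < p) : BoundedBelow l (verschiebung p a) := by
  obtain ⟨α, hα⟩ := h
  refine ⟨p * α, fun e he => ?_⟩
  by_cases h : ∃ w, p • w = e
  · obtain ⟨w, rfl⟩ := h
    rw [verschiebung_nsmul hp] at he
    rw [toReal_nsmul, map_smul, smul_eq_mul]
    exact mul_le_mul_of_nonneg_left (hα w he) p.cast_nonneg
  · exact absurd (verschiebung_of_notMem _ (not_exists.1 h)) he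

theorem substPow_coeff_nsmul (hp : 0 < p) (g : Laurent R n) (u : Fin n → ℤ) :
    (substPow p g).coeff (p • u) = g.coeff u :=
  Finsupp.mapDomain_apply (nsmul_injective_of_pos hp) g.coeff u

theorem exists_nsmul_of_substPow_coeff_ne_zero {g : Laurent R n} {e : Fin n → ℤ}
    (h : (substPow p g).coeff e ≠ 0) : ∃ w, p • w = e := by
  by_contra hne
  exact h (Finsupp.mapDomain_of_notMem_range g.coeff e fun ⟨w, hw⟩ => hne ⟨w, hw⟩)

theorem LowestTerm.substPow {l : (Fin n → ℝ) →L[ℝ] ℝ} {g : Laurent R n} {b : Fin n → ℤ}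
    (hg : LowestTerm l g b) (hp : 0 < p) : LowestTerm l (substPow p g) (p • b) := by
  refine ⟨by rw [substPow_coeff_nsmul hp]; exact hg.isUnit, fun a ha hne => ?_⟩
  obtain ⟨w, rfl⟩ := exists_nsmul_of_substPow_coeff_ne_zero ha
  rw [substPow_coeff_nsmul hp] at ha
  have := hg.lt w ha fun h => hne (by rw [h])
  rw [toReal_nsmul, toReal_nsmul, map_smul, map_smul, smul_eq_mul, smul_eq_mul]
  exact mul_lt_mul_of_pos_left this (by exact_mod_cast hp)

/-- The Cartier operator on Laurent polynomials. -/
def cartierPoly (hp : 0 < p) (g : Laurent R n) : Laurent R n :=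
  AddMonoidAlgebra.comapDomain _ (nsmul_injective_of_pos hp) g

theorem cartierPoly_coeff (hp : 0 < p) (g : Laurent R n) (e : Fin n → ℤ) :
    (cartierPoly hp g).coeff e = g.coeff (p • e) := rfl

/-- The projection formula: series in x^p can be pulled out of the Cartier operator. -/
theorem cartier_act_verschiebung (hp : 0 < p) (g : Laurent R n) (a : (Fin n → ℤ) → R) :
    cartier p (act g (verschiebung p a)) = act (cartierPoly hp g) a := by
  induction g using AddMonoidAlgebra.induction_linear with
  | zero => simp [cartierPoly]
  | add x y hx hy => simp [cartierPoly] at *; simp [hx, hy]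
  | single u c =>
    funext e
    rw [cartier_apply, act_mono]
    by_cases h : ∃ w, p • w = u
    · obtain ⟨w, rfl⟩ := h
      have : cartierPoly hp (mono (p • w) c) = mono w c :=
        AddMonoidAlgebra.comapDomain_single_map _ (nsmul_injective_of_pos hp) w c
      rw [this, act_mono, ← smul_sub, verschiebung_nsmul hp]
    · have : cartierPoly hp (mono u c) = 0 := by
        ext w
        rw [cartierPoly_coeff]
        exact Finsupp.single_eq_of_ne fun hw => h ⟨w, hw⟩
      rw [this, verschiebung_of_notMem, mul_zero, map_zero]
      · rfl
      intro w hw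
      exact h ⟨e - w, by rw [smul_sub, hw, sub_sub_cancel]⟩

end Action

/-! ### Expansions of f^{-m} at the vertex: supports and inverses. -/

section Expansion

variable {R : Type*} [CommRing R] {n : ℕ}

/-- The integral points of the cone `{λ (v - b) | v ∈ Δ, λ ≥ 0}`. -/
def InCone (f : Laurent R n) (b k : Fin n → ℤ) : Prop :=
  ∃ c : ℝ, 0 ≤ c ∧ ∃ v ∈ newton f, toReal k = c • (v - toReal b)

theorem toReal_mem_newton {f : Laurent R n} {a : Fin n → ℤ} (h : f.coeff a ≠ 0) :
    toReal a ∈ newton f := subset_convexHull ℝ _ ⟨a, h, rfl⟩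

theorem exists_smul_add_smul {E : Type*} [AddCommGroup E] [Module ℝ E] {s : Set E}
    (hs : Convex ℝ s) {x y : E} (hx : x ∈ s) (hy : y ∈ s) {α β : ℝ} (hα : 0 ≤ α) (hβ : 0 ≤ β) :
    ∃ z ∈ s, α • x + β • y = (α + β) • z := by
  rcases (add_nonneg hα hβ).eq_or_lt with h | h
  · obtain rfl : α = 0 := by linarith
    obtain rfl : β = 0 := by linarith
    exact ⟨x, hx, by simp⟩
  · refine ⟨(α / (α + β)) • x + (β / (α + β)) • y,
      hs hx hy (by positivity) (by positivity) (by field_simp), ?_⟩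
    rw [smul_add, smul_smul, smul_smul, mul_div_cancel₀ _ h.ne', mul_div_cancel₀ _ h.ne']

theorem InCone.add {f : Laurent R n} {b k k' : Fin n → ℤ} (h : InCone f b k)
    (h' : InCone f b k') : InCone f b (k + k') := by
  obtain ⟨c, hc, v, hv, hk⟩ := h
  obtain ⟨c', hc', v', hv', hk'⟩ := h'
  obtain ⟨z, hz, hz'⟩ := exists_smul_add_smul (convex_convexHull ℝ _) hv hv' hc hc'
  refine ⟨c + c', by positivity, z, hz, ?_⟩
  rw [toReal_add, hk, hk', smul_sub (c + c'), ← hz']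
  module

theorem InCone.zero {f : Laurent R n} {b : Fin n → ℤ} (hv : IsVertex f b) : InCone f b 0 :=
  ⟨0, le_rfl, toReal b, hv.1, by funext i; simp [toReal]⟩

theorem inCone_mul {f : Laurent R n} {b : Fin n → ℤ} {P Q : Laurent R n} {x y : Fin n → ℤ}
    (hP : ∀ e, P.coeff e ≠ 0 → InCone f b (e + x)) (hQ : ∀ e, Q.coeff e ≠ 0 → InCone f b (e + y))
    (e : Fin n → ℤ) (he : (P * Q).coeff e ≠ 0) : InCone f b (e + (x + y)) := by
  classical
  have h1 := AddMonoidAlgebra.support_coeff_mul_subset P Q (Finsupp.mem_support_iff.2 he)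
  obtain ⟨a, ha, c, hc, rfl⟩ := Finset.mem_add.1 h1
  rw [add_add_add_comm]
  exact (hP a (Finsupp.mem_support_iff.1 ha)).add (hQ c (Finsupp.mem_support_iff.1 hc))

theorem inCone_tail {f : Laurent R n} {b : Fin n → ℤ} (hv : IsVertex f b)
    (hu : IsUnit (f.coeff b)) (e : Fin n → ℤ) (he : (tail f b hu).coeff e ≠ 0) :
    InCone f b (e + 0) := by
  classical
  rw [add_zero]
  by_cases h0 : e = 0
  · rw [h0]
    exact InCone.zero hv
  · have h1 : (tail f b hu).coeff e =
        ((hu.unit⁻¹ : Rˣ) : R) * f.coeff (b + e) - (1 : Laurent R n).coeff e := by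
      simp [tail]
    have h2 : (1 : Laurent R n).coeff e = 0 := by
      simp [AddMonoidAlgebra.one_def, h0]
    have h3 : f.coeff (b + e) ≠ 0 := fun h => he (by rw [h1, h, h2]; simp)
    exact ⟨1, zero_le_one, _, toReal_mem_newton h3, by rw [toReal_add]; simp⟩

theorem inCone_tail_pow {f : Laurent R n} {b : Fin n → ℤ} (hv : IsVertex f b)
    (hu : IsUnit (f.coeff b)) (k : ℕ) (e : Fin n → ℤ) (he : (tail f b hu ^ k).coeff e ≠ 0) :
    InCone f b (e + 0) := by
  classical
  induction k generalizing e with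
  | zero =>
    have : e = 0 := by
      by_contra h0
      exact he (by simp [AddMonoidAlgebra.one_def, h0])
    rw [this, add_zero]
    exact InCone.zero hv
  | succ k ih =>
    rw [pow_succ] at he
    simpa using inCone_mul ih (inCone_tail hv hu) e he

/-- The tail is supported on differences a - b with a in the support of f, or at 0, and the cone is
closed under addition; the prefactor x^{-mb} accounts for the shift. -/
theorem inCone_series {f : Laurent R n} {b : Fin n → ℤ} (hv : IsVertex f b)
    (hu : IsUnit (f.coeff b)) (m : ℕ) (e : Fin n → ℤ) (he : series f b hu 1 m e ≠ 0) :
    InCone f b (e + m • b) := by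
  obtain ⟨k, hk⟩ := not_forall.1 fun h : ∀ k : ℕ, (-1 : R) ^ k * (Nat.multichoose m k : R) *
      (1 * mono (-b) ((hu.unit⁻¹ : Rˣ) : R) ^ m * tail f b hu ^ k).coeff e = 0 =>
    he ((finsum_congr h).trans finsum_zero)
  have h1 : (1 * mono (-b) ((hu.unit⁻¹ : Rˣ) : R) ^ m * tail f b hu ^ k).coeff e ≠ 0 :=
    fun h => hk (by rw [h, mul_zero])
  rw [one_mul, AddMonoidAlgebra.single_pow] at h1
  have h2 : ∀ e, (AddMonoidAlgebra.single (m • -b) (((hu.unit⁻¹ : Rˣ) : R) ^ m)).coeff e ≠ 0 →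
      InCone f b (e + m • b) := by
    intro e he
    have : m • -b = e := by
      by_contra hne
      exact he (Finsupp.single_eq_of_ne (Ne.symm hne))
    rw [← this, ← smul_add, neg_add_cancel, smul_zero]
    exact InCone.zero hv
  simpa using inCone_mul h2 (inCone_tail_pow hv hu k) e h1

theorem act_series {f : Laurent R n} {b : Fin n → ℤ} (hv : IsVertex f b)
    (hu : IsUnit (f.coeff b)) (g g' : Laurent R n) (m : ℕ) :
    act g (series f b hu g' m) = series f b hu (g * g') m := by
  induction g using AddMonoidAlgebra.induction_linear with
  | zero =>
    have := series_smul hv hu 0 g' m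
    simpa using this.symm
  | add x y hx hy => rw [map_add, LinearMap.add_apply, hx, hy, add_mul, series_add hv hu]
  | single u c =>
    funext e
    rw [act_mono, series, series, ← smul_eq_mul, smul_finsum' c (finite_terms hv hu _ _ _)]
    refine finsum_congr fun k => ?_
    rw [smul_eq_mul, mul_assoc (mono u c), mul_assoc (mono u c), mul_left_comm,
      AddMonoidAlgebra.coeff_single_mul_eq_mul_coeff (e - u), mul_assoc g']
    intro m _
    rw [eq_sub_iff_add_eq, add_comm]

theorem series_zero (f : Laurent R n) (b : Fin n → ℤ) (hu : IsUnit (f.coeff b)) (g : Laurent R n) :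
    series f b hu g 0 = ⇑g.coeff := by
  funext e
  rw [series, finsum_eq_single _ 0]
  · simp
  · intro k hk
    obtain ⟨k, rfl⟩ := Nat.exists_eq_succ_of_ne_zero hk
    simp

theorem act_pow_series {f : Laurent R n} {b : Fin n → ℤ} (hv : IsVertex f b)
    (hu : IsUnit (f.coeff b)) (m j : ℕ) :
    act (f ^ j) (series f b hu 1 (m + j)) = series f b hu 1 m := by
  rw [act_series hv hu, series_mul_pow hv hu]

/-- The expansion is an inverse of f^m under convolution. Identities between expansions are checked
by clearing denominators with this, then cancelling on bounded below families. -/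
theorem act_pow_series_self {f : Laurent R n} {b : Fin n → ℤ} (hv : IsVertex f b)
    (hu : IsUnit (f.coeff b)) (m : ℕ) :
    act (f ^ m) (series f b hu 1 m) = ⇑(1 : Laurent R n).coeff := by
  have := act_pow_series hv hu 0 m
  rwa [zero_add, series_zero] at this

theorem le_of_mem_newton {l : (Fin n → ℝ) →L[ℝ] ℝ} {f : Laurent R n} {b : Fin n → ℤ}
    (hl : LowestTerm l f b) {v : Fin n → ℝ} (hv : v ∈ newton f) : l (toReal b) ≤ l v := by
  have hc : Convex ℝ {v | l (toReal b) ≤ l v} :=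
    convex_halfSpace_ge l.toLinearMap.isLinear _
  refine convexHull_min ?_ hc hv
  rintro _ ⟨a, ha, rfl⟩
  by_cases h : a = b
  · rw [h, Set.mem_ofPred]
  · exact (hl.lt a ha h).le

theorem boundedBelow_series {l : (Fin n → ℝ) →L[ℝ] ℝ} {f : Laurent R n} {b : Fin n → ℤ}
    (hl : LowestTerm l f b) (hv : IsVertex f b) (m : ℕ) :
    BoundedBelow l (series f b hl.isUnit 1 m) := by
  refine ⟨-(m * l (toReal b)), fun e he => ?_⟩
  obtain ⟨c, hc, v, hv, h⟩ := inCone_series hv hl.isUnit m e he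
  have h1 := congrArg l h
  rw [toReal_add, toReal_nsmul, map_add, map_smul, map_smul, map_sub, smul_eq_mul, smul_eq_mul] at h1
  have := mul_nonneg hc (sub_nonneg.2 (le_of_mem_newton hl hv))
  linarith

theorem expand_omega (f : Laurent R n) (b : Fin n → ℤ) (hv : IsVertex f b)
    (hu : IsUnit (f.coeff b)) (k : ℕ) (u : Fin n → ℤ) :
    expand f b hv hu (omega f k u) =
      ((k - 1).factorial : R) • act (mono u 1) (series f b hu 1 k) := by
  rw [omega, map_smul, act_series hv hu, mul_one, expand_eq f b hv hu (m := k) (g := mono u 1)]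
  rw [mul_assoc, map_pow, ← mul_pow, mul_comm (IsLocalization.Away.invSelf f),
    IsLocalization.Away.mul_invSelf, one_pow, mul_one]

/-- The span of the expansions of the functions `(k - 1)! x^u / f^k`, for `(k, u)` in `P`. -/
def expansionSpan (f : Laurent R n) (b : Fin n → ℤ) (hu : IsUnit (f.coeff b))
    (P : Set (ℕ × (Fin n → ℤ))) : Submodule R ((Fin n → ℤ) → R) :=
  Submodule.span R ((fun w : ℕ × (Fin n → ℤ) =>
    ((w.1 - 1).factorial : R) • act (mono w.2 1) (series f b hu 1 w.1)) '' P)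

theorem expand_mem_expansionSpan {f : Laurent R n} {b : Fin n → ℤ} (hv : IsVertex f b)
    (hu : IsUnit (f.coeff b)) (μ : FaceOpen f) {r : RegFun f} (hr : r ∈ Omega μ) :
    expand f b hv hu r ∈ expansionSpan f b hu (conePoints μ) := by
  have : Omega μ ≤ (expansionSpan f b hu (conePoints μ)).comap (expand f b hv hu) := by
    refine Submodule.span_le.2 ?_
    rintro _ ⟨w, hw, rfl⟩
    refine Submodule.subset_span ⟨w, hw, ?_⟩
    simp only [expand_omega]
  exact this hr

theorem expansionSpan_le_omegaFormal {f : Laurent R n} {b : Fin n → ℤ} (hv : IsVertex f b)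
    (hu : IsUnit (f.coeff b)) (μ : FaceOpen f) :
    expansionSpan f b hu (conePoints μ) ≤ OmegaFormal f b := by
  refine Submodule.span_le.2 ?_
  rintro _ ⟨⟨k, u⟩, ⟨_, v, hvμ, hk⟩, rfl⟩
  refine Submodule.smul_mem _ _ fun e he => ?_
  rw [act_mono, one_mul] at he
  have h1 := inCone_series hv hu k _ he
  have h2 : InCone f b (u - k • b) := by
    refine ⟨k, k.cast_nonneg, v, μ.subset hvμ, ?_⟩
    simp only at hk
    rw [toReal_sub, toReal_nsmul, hk, smul_sub]
  have h3 : InCone f b (e - u + k • b + (u - k • b)) := h1.add h2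
  rwa [show e - u + k • b + (u - k • b) = e by abel] at h3

end Expansion

/-! ### Open sets of faces, and cones. -/

section FaceTopology

variable {R : Type*} [CommRing R] {n : ℕ}

/-- Openness of μ enters here. A face containing an interior point of a segment from v to w contains
v, so such a point cannot lie in the complement of μ when v is in μ. Hence the cone over μ absorbs
the cone over Δ. -/
theorem FaceOpen.exists_smul_add_smul {f : Laurent R n} (μ : FaceOpen f) {v w : Fin n → ℝ}
    (hv : v ∈ μ.carrier) (hw : w ∈ newton f) {α β : ℝ} (hα : 0 < α) (hβ : 0 ≤ β) :
    ∃ z ∈ μ.carrier, α • v + β • w = (α + β) • z := by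
  rcases hβ.eq_or_lt with rfl | hβ
  · exact ⟨v, hv, by simp⟩
  have hs : 0 < α + β := by linarith
  set z := (α / (α + β)) • v + (β / (α + β)) • w with hz
  have hseg : z ∈ openSegment ℝ v w :=
    ⟨_, _, div_pos hα hs, div_pos hβ hs, by field_simp, rfl⟩
  have hzn : z ∈ newton f :=
    (convex_convexHull ℝ _).segment_subset (μ.subset hv) hw (openSegment_subset_segment _ _ _ hseg)
  refine ⟨z, ?_, ?_⟩
  · by_contra hne
    obtain ⟨faces, h1, h2⟩ := μ.isOpen
    have h3 : z ∈ newton f \ μ.carrier := ⟨hzn, hne⟩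
    rw [h2] at h3
    obtain ⟨F, hF, hzF⟩ := h3
    have h4 := (h1 F hF).isExtreme.left_mem_of_mem_openSegment (μ.subset hv) hw hzF hseg
    have h5 : v ∈ newton f \ μ.carrier := by
      rw [h2]
      exact ⟨F, hF, h4⟩
    exact h5.2 hv
  · rw [hz, smul_add, smul_smul, smul_smul, mul_div_cancel₀ _ hs.ne', mul_div_cancel₀ _ hs.ne']

/-- The support of `g` is contained in `t Δ`, where `Δ` is the Newton polytope of `f`. -/
def SupportedIn (f : Laurent R n) (t : ℕ) (g : Laurent R n) : Prop :=
  ∀ e, g.coeff e ≠ 0 → ∃ v ∈ newton f, toReal e = (t : ℝ) • v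

theorem SupportedIn.mul {f g g' : Laurent R n} {t t' : ℕ} (h : SupportedIn f t g)
    (h' : SupportedIn f t' g') : SupportedIn f (t + t') (g * g') := by
  classical
  intro e he
  have h1 := AddMonoidAlgebra.support_coeff_mul_subset g g' (Finsupp.mem_support_iff.2 he)
  obtain ⟨a, ha, c, hc, rfl⟩ := Finset.mem_add.1 h1
  obtain ⟨v, hv, hv'⟩ := h a (Finsupp.mem_support_iff.1 ha)
  obtain ⟨w, hw, hw'⟩ := h' c (Finsupp.mem_support_iff.1 hc)
  obtain ⟨z, hz, hz'⟩ := UnitRootCrystal.exists_smul_add_smul (convex_convexHull ℝ _) hv hw t.cast_nonneg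
    t'.cast_nonneg
  exact ⟨z, hz, by rw [toReal_add, hv', hw', hz', Nat.cast_add]⟩

theorem SupportedIn.one {f : Laurent R n} (hf : (newton f).Nonempty) : SupportedIn f 0 1 := by
  classical
  intro e he
  have h0 : e = 0 := by
    by_contra h0
    exact he (by simp [AddMonoidAlgebra.one_def, h0])
  obtain ⟨v, hv⟩ := hf
  exact ⟨v, hv, by rw [h0]; funext i; simp [toReal]⟩

theorem SupportedIn.pow {f g : Laurent R n} {t : ℕ} (hf : (newton f).Nonempty)
    (h : SupportedIn f t g) (k : ℕ) : SupportedIn f (k * t) (g ^ k) := by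
  induction k with
  | zero => simpa using SupportedIn.one hf
  | succ k ih =>
    rw [pow_succ, Nat.succ_mul]
    exact ih.mul h

theorem SupportedIn.sub {f g g' : Laurent R n} {t : ℕ} (h : SupportedIn f t g)
    (h' : SupportedIn f t g') : SupportedIn f t (g - g') := by
  intro e he
  by_cases h0 : g.coeff e = 0
  · exact h' e fun h1 => he (by simp [h0, h1])
  · exact h e h0

theorem SupportedIn.of_newton {f g : Laurent R n} (h : ∀ e, g.coeff e ≠ 0 → f.coeff e ≠ 0) :
    SupportedIn f 1 g := fun e he => ⟨_, toReal_mem_newton (h e he), by simp⟩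

theorem SupportedIn.substPow {f g : Laurent R n} {t p : ℕ} (h : SupportedIn f t g) (hp : 0 < p) :
    SupportedIn f (p * t) (substPow p g) := by
  intro e he
  obtain ⟨w, rfl⟩ := exists_nsmul_of_substPow_coeff_ne_zero he
  rw [substPow_coeff_nsmul hp] at he
  obtain ⟨v, hv, hw⟩ := h w he
  exact ⟨v, hv, by rw [toReal_nsmul, hw, smul_smul, Nat.cast_mul]⟩

theorem mem_conePoints_of_mono_mul {f g : Laurent R n} {μ : FaceOpen f} {m t : ℕ}
    {u : Fin n → ℤ} (hu : (m, u) ∈ conePoints μ) (hg : SupportedIn f t g) {e : Fin n → ℤ}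
    (he : (mono u 1 * g).coeff e ≠ 0) : (m + t, e) ∈ conePoints μ := by
  classical
  have h1 := AddMonoidAlgebra.support_coeff_mul_subset _ g (Finsupp.mem_support_iff.2 he)
  obtain ⟨a, ha, c, hc, rfl⟩ := Finset.mem_add.1 h1
  obtain rfl : u = a := by
    by_contra hne
    exact Finsupp.mem_support_iff.1 ha (Finsupp.single_eq_of_ne (Ne.symm hne))
  obtain ⟨hm, v, hv, hv'⟩ := hu
  obtain ⟨w, hw, hw'⟩ := hg c (Finsupp.mem_support_iff.1 hc)
  obtain ⟨z, hz, hz'⟩ := μ.exists_smul_add_smul hv hw (α := m) (β := t) (by exact_mod_cast hm)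
    t.cast_nonneg
  simp only at hm hv'
  exact ⟨by simp only; omega, z, hz, by simp only [toReal_add, hv', hw', hz', Nat.cast_add]⟩

theorem mem_conePoints_of_nsmul {f : Laurent R n} {μ : FaceOpen f} {p k : ℕ} (hp : 0 < p)
    {w : Fin n → ℤ} (h : (p * k, p • w) ∈ conePoints μ) : (k, w) ∈ conePoints μ := by
  obtain ⟨h1, z, hz, h2⟩ := h
  refine ⟨pos_of_mul_pos_right h1 p.zero_le, z, hz, ?_⟩
  simp only [toReal_nsmul, Nat.cast_mul, mul_smul] at h2
  exact smul_right_injective _ (by exact_mod_cast hp.ne') h2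

theorem mem_lattice_of_mem_conePoints {f : Laurent R n} {μ : FaceOpen f} {w : Fin n → ℤ}
    (h : (1, w) ∈ conePoints μ) : w ∈ μ.lattice := by
  obtain ⟨_, z, hz, h2⟩ := h
  have : toReal w = z := by simpa using h2
  rw [FaceOpen.lattice, Set.mem_ofPred, this]
  exact hz

end FaceTopology

/-! ### Truncated binomial series and factorials. -/

section Arithmetic

/-- This is the binomial series of (a - x)^{-k} in powers of x / a, cut off after N terms, with
denominators cleared. -/
theorem exists_truncated_binomial {S : Type*} [CommRing S] (a x : S) (k N : ℕ) :
    ∃ q, (a - x) ^ k * ∑ r ∈ Finset.range N, (Nat.multichoose k r : S) * x ^ r * a ^ (N - r) =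
      a ^ (k + N) + x ^ N * q := by
  cases N with
  | zero => exact ⟨-a ^ k, by simp⟩
  | succ N =>
  set T : ℕ → ℕ → S := fun k N =>
    ∑ r ∈ Finset.range (N + 1), (Nat.multichoose k r : S) * x ^ r * a ^ (N + 1 - r) with hT
  have hsucc : ∀ k N, T k (N + 1) = a * T k N + Nat.multichoose k (N + 1) * x ^ (N + 1) * a := by
    intro k N
    simp only [hT]
    rw [Finset.sum_range_succ _ (N + 1), Finset.mul_sum]
    congr 1
    · refine Finset.sum_congr rfl fun r hr => ?_
      rw [show N + 1 + 1 - r = N + 1 - r + 1 by have := Finset.mem_range.1 hr; omega, pow_succ]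
      ring
    · rw [Nat.add_sub_cancel_left, pow_one]
  -- Multiplication by a - x lowers the exponent by one, up to a boundary term of order N + 1 in x;
  -- this is the Pascal rule for `multichoose`.
  have hstep : ∀ k N, (a - x) * T (k + 1) N =
      a * T k N - Nat.multichoose (k + 1) N * x ^ (N + 1) * a := by
    intro k N
    induction N with
    | zero => simp [hT]; ring
    | succ N ih =>
      rw [hsucc, hsucc, mul_add, mul_left_comm, ih, Nat.multichoose_succ_succ]
      push_cast
      ring
  change ∃ q, (a - x) ^ k * T k N = _
  induction k with
  | zero =>
    refine ⟨0, ?_⟩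
    simp only [hT]
    rw [Finset.sum_range_succ', Finset.sum_eq_zero]
    · simp
    · intro r _
      simp
  | succ k ih =>
    obtain ⟨q, hq⟩ := ih
    refine ⟨a * q - (a - x) ^ k * Nat.multichoose (k + 1) N * a, ?_⟩
    rw [pow_succ, mul_assoc, hstep, mul_sub, mul_left_comm, hq]
    ring

theorem isUnit_natCast_of_coprime {R : Type*} [CommRing R] {p q : ℕ}
    (hp : (p : R) ∈ (⊥ : Ideal R).jacobson) (h : Nat.Coprime p q) : IsUnit (q : R) := by
  have h1 : ((p : ℤ) * Nat.gcdA p q + q * Nat.gcdB p q : ℤ) = 1 := by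
    rw [← Nat.gcd_eq_gcd_ab, h]; rfl
  have h2 : (p : R) * (Nat.gcdA p q : R) + q * (Nat.gcdB p q : R) = 1 := by
    have := congrArg (Int.cast : ℤ → R) h1
    push_cast at this
    exact this
  have h3 := Ideal.mem_jacobson_bot.1 hp (-(Nat.gcdA p q : R))
  rw [show (p : R) * -(Nat.gcdA p q : R) + 1 = q * (Nat.gcdB p q : R) by
    rw [← h2]; ring] at h3
  exact isUnit_of_mul_isUnit_left h3

/-- The p-adic valuation of (r + 1)! is at most r and its prime-to-p part is a unit of R, so p^{r+1}
/ (r + 1)! exists in R and is divisible by p. -/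
theorem exists_factorial_mul_eq_pow {R : Type*} [CommRing R] {p : ℕ} [hpp : Fact p.Prime]
    (hp : (p : R) ∈ (⊥ : Ideal R).jacobson) (r : ℕ) :
    ∃ t : R, ((r + 1).factorial : R) * (p * t) = (p : R) ^ (r + 1) := by
  obtain ⟨v, q, hq, h⟩ := Nat.exists_eq_pow_mul_and_not_dvd (Nat.factorial_ne_zero (r + 1)) p
    hpp.out.ne_one
  have hv : v ≤ r := by
    have h1 := padicValNat_factorial_lt_of_ne_zero (p := p) (n := r + 1) (by omega)
    rw [h, padicValNat.mul (pow_ne_zero _ hpp.out.ne_zero) (by rintro rfl; simp at hq),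
      padicValNat.prime_pow, padicValNat.eq_zero_of_not_dvd hq] at h1
    omega
  obtain ⟨c, hc⟩ := (isUnit_natCast_of_coprime hp
    ((Nat.Prime.coprime_iff_not_dvd hpp.out).2 hq)).exists_right_inv
  refine ⟨p ^ (r - v) * c, ?_⟩
  rw [h]
  push_cast
  calc (p : R) ^ v * q * (p * (p ^ (r - v) * c)) = p ^ (v + 1 + (r - v)) * (q * c) := by ring
    _ = _ := by rw [hc, mul_one]; congr 1; omega

/-- Used to show that the leading term of C(ω_{(m,u)}) is divisible by p when its new pole order k +
1 exceeds 1. -/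
theorem mul_factorial_dvd_factorial {p k m : ℕ} (hp : 0 < p) (hk : 0 < k) (h : p * k < m) :
    p * k.factorial ∣ (m - 1).factorial := by
  refine dvd_trans ?_ (Nat.factorial_dvd_factorial (show p * k ≤ m - 1 by omega))
  obtain ⟨k, rfl⟩ := Nat.exists_eq_succ_of_ne_zero hk.ne'
  rw [← Nat.mul_factorial_pred (Nat.mul_pos hp hk).ne', Nat.factorial_succ, ← mul_assoc]
  refine mul_dvd_mul_left _ (Nat.factorial_dvd_factorial ?_)
  exact Nat.le_sub_one_of_lt (Nat.lt_of_lt_of_le k.lt_succ_self (Nat.le_mul_of_pos_left _ hp))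

theorem multichoose_mul_factorial {k : ℕ} (hk : 0 < k) (r : ℕ) :
    (k - 1).factorial * Nat.multichoose k r * r.factorial = (k + r - 1).factorial := by
  rw [Nat.multichoose_eq]
  have := Nat.choose_mul_factorial_mul_factorial (n := k + r - 1) (k := r) (by omega)
  rw [show k + r - 1 - r = k - 1 by omega] at this
  rw [← this]
  ring

end Arithmetic

/-! ### The Frobenius congruence and the expansion of f^{-m} in powers of pG. -/

section Frobenius

variable {R : Type*} [CommRing R] {n : ℕ}

/-- Application of a ring endomorphism to the coefficients of a Laurent polynomial. -/
abbrev twist (σ : R →+* R) : Laurent R n →+* Laurent R n := AddMonoidAlgebra.mapRingHom _ σ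

/-- Additivity of the p-th power modulo p reduces this to monomials, where it is the hypothesis on
σ. -/
theorem exists_substPow_twist_eq {p : ℕ} (hp : p.Prime) {σ : R →+* R}
    (hσ : ∀ r : R, σ r - r ^ p ∈ pIdeal R p) (f : Laurent R n) :
    ∃ G, substPow p (twist σ f) = f ^ p + p * G := by
  induction f using AddMonoidAlgebra.induction_linear with
  | zero => exact ⟨0, by simp [hp.ne_zero]⟩
  | add x y hx hy =>
    obtain ⟨G, hG⟩ := hx
    obtain ⟨G', hG'⟩ := hy
    obtain ⟨r, hr⟩ := exists_add_pow_prime_eq hp x y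
    exact ⟨G + G' - x * y * r, by rw [map_add, map_add, hG, hG', hr]; ring⟩
  | single u c =>
    obtain ⟨r, hr⟩ := Ideal.mem_span_singleton'.1 (hσ c)
    refine ⟨mono (p • u) r, ?_⟩
    rw [AddMonoidAlgebra.mapRingHom_single, substPow_mono, AddMonoidAlgebra.single_pow,
      ← map_natCast (algebraMap R (Laurent R n)), ← Algebra.smul_def, AddMonoidAlgebra.smul_single,
      ← AddMonoidAlgebra.single_add, smul_eq_mul, mul_comm (p : R), hr, add_sub_cancel]

theorem LowestTerm.mem_of_act_pow_mem {l : (Fin n → ℝ) →L[ℝ] ℝ} {g : Laurent R n}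
    {b : Fin n → ℤ} (hg : LowestTerm l g b) (I : Ideal R) (m : ℕ) {a : (Fin n → ℤ) → R}
    (ha : BoundedBelow l a) (h : ∀ e, act (g ^ m) a e ∈ I) (e : Fin n → ℤ) : a e ∈ I := by
  induction m generalizing a e with
  | zero => simpa using h e
  | succ m ih =>
    refine hg.mem_of_act_mem I ha (ih (ha.act g) fun e => ?_) e
    rw [← act_mul, ← pow_succ]
    exact h e

theorem smul_coe_coeff (c : R) (g : Laurent R n) : c • ⇑g.coeff = ⇑(c • g).coeff := rfl

theorem natCast_mul_pow_smul (a p r : ℕ) (g : Laurent R n) :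
    ((a : R) * (p : R) ^ r) • g = (a : Laurent R n) * (p : Laurent R n) ^ r * g := by
  rw [Algebra.smul_def, map_mul, map_pow, map_natCast, map_natCast]

theorem coe_coeff_sum {κ : Type*} (s : Finset κ) (g : κ → Laurent R n) :
    ⇑(∑ i ∈ s, g i).coeff = ∑ i ∈ s, ⇑(g i).coeff := by
  rw [AddMonoidAlgebra.coeff_sum, Finsupp.coe_finsetSum]

/-- The expansion `f^{-m} = f^t (f^p)^{-k} = f^t ∑_r (k + r - 1 choose r) p^r G^r Φ^{-k-r}`, up to a
multiple of `p ^ N`, for `m + t = p k` and `f^p = Φ - p G` with `Φ = f₁(x^p)`. -/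
theorem exists_series_eq {l : (Fin n → ℝ) →L[ℝ] ℝ} {p : ℕ} (hp : 0 < p) {f f₁ G : Laurent R n}
    {b : Fin n → ℤ} (hl : LowestTerm l f b) (hl₁ : LowestTerm l f₁ b) (hv : IsVertex f b)
    (hv₁ : IsVertex f₁ b) (hG : substPow p f₁ = f ^ p + p * G) {m t k : ℕ} (hm : m + t = p * k)
    (N : ℕ) : ∃ x, series f b hl.isUnit 1 m =
      ∑ r ∈ Finset.range N, ((Nat.multichoose k r : R) * (p : R) ^ r) •
        act (f ^ t * G ^ r) (verschiebung p (series f₁ b hl₁.isUnit 1 (k + r))) +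
      (p : R) ^ N • x := by
  set S := ∑ r ∈ Finset.range N, ((Nat.multichoose k r : R) * (p : R) ^ r) •
    act (f ^ t * G ^ r) (verschiebung p (series f₁ b hl₁.isUnit 1 (k + r))) with hS
  set Φ := substPow p f₁ with hΦ
  obtain ⟨q, hq⟩ := exists_truncated_binomial Φ (p * G) k N
  have hfp : Φ - p * G = f ^ p := by rw [hG]; ring
  rw [hfp, ← pow_mul, ← hm] at hq
  -- Substituting x^p in the expansion of f₁^{-j} gives an inverse of Φ^j.
  have hY : ∀ j, act (Φ ^ j) (verschiebung p (series f₁ b hl₁.isUnit 1 j)) =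
      ⇑(1 : Laurent R n).coeff := by
    intro j
    rw [hΦ, ← map_pow, ← verschiebung_act hp, act_pow_series_self hv₁, verschiebung_one hp]
  have hbd : BoundedBelow l (series f b hl.isUnit 1 m - S) :=
    (boundedBelow_series hl hv m).sub (BoundedBelow.sum fun r _ =>
      (((boundedBelow_series hl₁ hv₁ _).verschiebung hp).act _).smul _)
  have h1 : act (f ^ m) (act (Φ ^ (k + N)) S) = ⇑(Φ ^ (k + N) + (p * G) ^ N * q).coeff := by
    rw [← hq, ← act_mul, hS, map_sum, Finset.mul_sum, coe_coeff_sum]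
    refine Finset.sum_congr rfl fun r hr => ?_
    have hr' := Finset.mem_range.1 hr
    rw [map_smul, ← act_mul, show f ^ m * Φ ^ (k + N) * (f ^ t * G ^ r) =
      (f ^ (m + t) * G ^ r * Φ ^ (N - r)) * Φ ^ (k + r) by
        rw [show k + N = (k + r) + (N - r) by omega]; ring, act_mul, hY, act_coeff, mul_one]
    refine (smul_coe_coeff _ _).trans (congrArg (fun g : Laurent R n => ⇑g.coeff) ?_)
    rw [natCast_mul_pow_smul, mul_pow]
    ring
  have h2 : act (f ^ m) (act (Φ ^ (k + N)) (series f b hl.isUnit 1 m)) = ⇑(Φ ^ (k + N)).coeff := by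
    rw [← act_mul, mul_comm, act_mul, act_pow_series_self hv, act_coeff, mul_one]
  -- After multiplication by f^m Φ^{k+N}, the two sides differ by (pG)^N q. Both f and Φ have lowest
  -- terms with unit coefficients, so they can be cancelled modulo p^N.
  have h3 : ∀ e, (series f b hl.isUnit 1 m - S) e ∈ Ideal.span {(p : R) ^ N} := by
    refine (hl₁.substPow hp).mem_of_act_pow_mem _ (k + N) hbd
      (hl.mem_of_act_pow_mem _ m (hbd.act _) fun e => ?_)
    rw [map_sub, map_sub, ← hΦ, h1, h2, ← Finsupp.coe_sub, ← AddMonoidAlgebra.coeff_sub,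
      sub_add_cancel_left, mul_pow, mul_assoc, ← mul_neg]
    have : ((p : Laurent R n)) ^ N * -(G ^ N * q) = ((1 : ℕ) * (p : R) ^ N) • -(G ^ N * q) := by
      rw [natCast_mul_pow_smul, Nat.cast_one, one_mul]
    rw [this, Nat.cast_one, one_mul, ← smul_coe_coeff]
    exact Ideal.mul_mem_right _ _ (Ideal.mem_span_singleton_self _)
  choose x hx using fun e => Ideal.mem_span_singleton'.1 (h3 e)
  refine ⟨x, ?_⟩
  rw [← sub_eq_iff_eq_add']
  funext e
  rw [← hx e, mul_comm]
  rfl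

end Frobenius

/-! ### The Cartier operator on the expansions of ω_{(m,u)}. -/

section CartierExpansion

variable {R : Type*} [CommRing R] {n : ℕ}

theorem act_eq_sum (q : Laurent R n) (a : (Fin n → ℤ) → R) :
    act q a = ∑ w ∈ q.coeff.support, q.coeff w • act (mono w 1) a := by
  funext e
  rw [act_apply, Finset.sum_apply]
  exact Finset.sum_congr rfl fun w _ => by rw [Pi.smul_apply, act_mono, one_mul, smul_eq_mul]

theorem act_eq_sum_subtype {P : Set (Fin n → ℤ)} [Fintype P] {q : Laurent R n}
    (hq : ∀ w, q.coeff w ≠ 0 → w ∈ P) (a : (Fin n → ℤ) → R) :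
    act q a = ∑ w : P, q.coeff (w : Fin n → ℤ) • act (mono (w : Fin n → ℤ) 1) a := by
  classical
  rw [act_eq_sum, Finset.sum_subset (s₂ := P.toFinset)]
  · exact (Finset.sum_subtype _ (fun _ => Set.mem_toFinset) _)
  · intro w hw
    exact Set.mem_toFinset.2 (hq w (Finsupp.mem_support_iff.1 hw))
  · intro w _ hw
    rw [Finsupp.notMem_support_iff.1 hw, zero_smul]

theorem factorial_smul_act_mem {f : Laurent R n} {b : Fin n → ℤ} (hu : IsUnit (f.coeff b))
    {P : Set (ℕ × (Fin n → ℤ))} {q : Laurent R n} {i : ℕ}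
    (hq : ∀ w, q.coeff w ≠ 0 → (i, w) ∈ P) :
    ((i - 1).factorial : R) • act q (series f b hu 1 i) ∈ expansionSpan f b hu P := by
  rw [act_eq_sum, Finset.smul_sum]
  refine Submodule.sum_mem _ fun w hw => ?_
  rw [smul_comm]
  exact Submodule.smul_mem _ _
    (Submodule.subset_span ⟨(i, w), hq w (Finsupp.mem_support_iff.1 hw), rfl⟩)

/-- A Laurent polynomial with support inside that of `f₀`, for which `b` is still a vertex, with a
unit as coefficient, and the unique minimum of `l`. -/
structure Companion (l : (Fin n → ℝ) →L[ℝ] ℝ) (f₀ : Laurent R n) (b : Fin n → ℤ)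
    (f : Laurent R n) : Prop where
  lowest : LowestTerm l f b
  isVertex : IsVertex f b
  support : ∀ e, f.coeff e ≠ 0 → f₀.coeff e ≠ 0

/-- Since σ may kill coefficients, the Newton polytope may shrink; but b stays in it because σ
preserves units, and an extreme point of a set is extreme in each subset containing it. -/
theorem Companion.twist {l : (Fin n → ℝ) →L[ℝ] ℝ} {f₀ f : Laurent R n} {b : Fin n → ℤ}
    [Nontrivial R] (h : Companion l f₀ b f) (σ : R →+* R) : Companion l f₀ b (twist σ f) := by
  have hc : ∀ e, (UnitRootCrystal.twist σ f).coeff e = σ (f.coeff e) := fun e =>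
    AddMonoidAlgebra.coeff_mapRingHom _ _ _
  have hs : ∀ e, (UnitRootCrystal.twist σ f).coeff e ≠ 0 → f.coeff e ≠ 0 := fun e he h0 =>
    he (by rw [hc, h0, map_zero])
  have hu : IsUnit ((UnitRootCrystal.twist σ f).coeff b) := by
    rw [hc]
    exact h.lowest.isUnit.map σ
  refine ⟨⟨hu, fun a ha => h.lowest.lt a (hs a ha)⟩, ?_, fun e he => h.support e (hs e he)⟩
  refine inter_extremePoints_subset_extremePoints_of_subset (convexHull_mono ?_)
    ⟨toReal_mem_newton hu.ne_zero, h.isVertex⟩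
  exact Set.image_mono fun e he => hs e he

variable {l : (Fin n → ℝ) →L[ℝ] ℝ} {p : ℕ} {f₀ f f₁ G : Laurent R n} {b : Fin n → ℤ}

theorem supportedIn_of_substPow_eq [IsDomain R] [CharZero R] (hp : 0 < p)
    (hne : (newton f₀).Nonempty) (h : SupportedIn f₀ 1 f) (h₁ : SupportedIn f₀ 1 f₁)
    (hG : substPow p f₁ = f ^ p + p * G) : SupportedIn f₀ p G := by
  have h2 : SupportedIn f₀ p (p * G) := by
    rw [← sub_eq_iff_eq_add'.2 hG]
    simpa using (h₁.substPow hp).sub (by simpa using h.pow hne p)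
  intro e he
  refine h2 e ?_
  rw [← nsmul_eq_mul, AddMonoidAlgebra.coeff_smul, Finsupp.smul_apply, nsmul_eq_mul]
  exact mul_ne_zero (by exact_mod_cast hp.ne') he

/-- The term r of the expansion has denominator f₁^{k+r} and, with d = (m - 1)! / (k - 1)!,
coefficient (k + r - 1)! · d · p^r / r!. For r ≥ 1 the factor p^r / r! is divisible by p, so only r
= 0 survives modulo p. -/
theorem cartier_generator [Fact p.Prime] (hpJ : (p : R) ∈ (⊥ : Ideal R).jacobson)
    (hp : 0 < p) (hf : Companion l f₀ b f) (hf₁ : Companion l f₀ b f₁)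
    (hGs : SupportedIn f₀ p G) (hG : substPow p f₁ = f ^ p + p * G) (μ : FaceOpen f₀)
    {m t k : ℕ} {u : Fin n → ℤ} (hu : (m, u) ∈ conePoints μ) (hk : 0 < k) (hm : m + t = p * k)
    (hd : (k - 1).factorial ∣ (m - 1).factorial) (N : ℕ) :
    (∀ w, (cartierPoly hp (mono u 1 * f ^ t)).coeff w ≠ 0 → (k, w) ∈ conePoints μ) ∧
    ∃ a ∈ expansionSpan f₁ b hf₁.lowest.isUnit (conePoints μ), ∃ x,
      cartier p (((m - 1).factorial : R) • act (mono u 1) (series f b hf.lowest.isUnit 1 m)) =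
        ((m - 1).factorial : R) • act (cartierPoly hp (mono u 1 * f ^ t))
          (series f₁ b hf₁.lowest.isUnit 1 k) + (p : R) • a + (p : R) ^ N • x := by
  have hne : (newton f₀).Nonempty := ⟨_, μ.subset hu.2.choose_spec.1⟩
  have hft : SupportedIn f₀ t (f ^ t) := by
    simpa using (SupportedIn.of_newton hf.support).pow hne t
  have hmem : ∀ r w, (cartierPoly hp (mono u 1 * (f ^ t * G ^ r))).coeff w ≠ 0 →
      (k + r, w) ∈ conePoints μ := by
    intro r w hw
    rw [cartierPoly_coeff] at hw
    have := mem_conePoints_of_mono_mul hu (hft.mul (hGs.pow hne r)) hw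
    -- The numerator x^u f^t G^r has degree m + t + rp = p(k + r) over the cone of μ, so division of
    -- exponents by p leaves degree k + r.
    rw [show m + (t + r * p) = p * (k + r) by rw [← add_assoc, hm]; ring] at this
    exact mem_conePoints_of_nsmul hp this
  refine ⟨by simpa using hmem 0, ?_⟩
  obtain ⟨d, hd⟩ := hd
  choose τ hτ using exists_factorial_mul_eq_pow hpJ
  -- N + 1 terms: the leading one, and N more that make up `a`.
  obtain ⟨x, hx⟩ := exists_series_eq hp hf.lowest hf₁.lowest hf.isVertex hf₁.isVertex hG hm (N + 1)
  have hproj : ∀ r, cartier p (act (mono u 1) (act (f ^ t * G ^ r)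
      (verschiebung p (series f₁ b hf₁.lowest.isUnit 1 (k + r))))) =
      act (cartierPoly hp (mono u 1 * (f ^ t * G ^ r))) (series f₁ b hf₁.lowest.isUnit 1 (k + r)) := by
    intro r
    rw [← act_mul, cartier_act_verschiebung hp]
  refine ⟨∑ r ∈ Finset.range N, ((d : R) * τ r) • (((k + (r + 1) - 1).factorial : R) •
      act (cartierPoly hp (mono u 1 * (f ^ t * G ^ (r + 1)))) 
        (series f₁ b hf₁.lowest.isUnit 1 (k + (r + 1)))),
    Submodule.sum_mem _ fun r _ => Submodule.smul_mem _ _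
      (factorial_smul_act_mem _ (hmem (r + 1))),
    ((p : R) * ((m - 1).factorial : R)) • cartier p (act (mono u 1) x), ?_⟩
  rw [hx, Finset.sum_range_succ']
  simp only [map_add, map_sum, map_smul, hproj, smul_add, Finset.smul_sum, smul_smul]
  rw [add_comm (Finset.sum _ _)]
  congr 1
  · congr 1
    · simp only [pow_zero, mul_one, add_zero, Nat.multichoose_zero_right, Nat.cast_one]
    · refine Finset.sum_congr rfl fun r _ => ?_
      congr 1
      rw [← multichoose_mul_factorial hk (r + 1), ← hτ r, hd]
      push_cast
      ring
  · congr 1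
    ring

/-- The least admissible new pole order is ⌈m/p⌉. If it is 1, the leading term is a combination of
the ω_w with w in μ_ℤ; otherwise (m - 1)! supplies the extra factor p, and the leading term joins
`a`. -/
theorem cartier_generator_mem [Fact p.Prime] (hpJ : (p : R) ∈ (⊥ : Ideal R).jacobson)
    (hp : 0 < p) (hf : Companion l f₀ b f) (hf₁ : Companion l f₀ b f₁)
    (hGs : SupportedIn f₀ p G) (hG : substPow p f₁ = f ^ p + p * G) (μ : FaceOpen f₀)
    {m : ℕ} {u : Fin n → ℤ} (hu : (m, u) ∈ conePoints μ) (N : ℕ) :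
    ∃ c : μ.lattice → R, ∃ a ∈ expansionSpan f₁ b hf₁.lowest.isUnit (conePoints μ), ∃ x,
      cartier p (((m - 1).factorial : R) • act (mono u 1) (series f b hf.lowest.isUnit 1 m)) =
        ∑ w : μ.lattice, c w • act (mono (w : Fin n → ℤ) 1)
          (series f₁ b hf₁.lowest.isUnit 1 1) + (p : R) • a + (p : R) ^ N • x := by
  have hm0 : 0 < m := hu.1
  -- Here k + 1 = ⌈m/p⌉, so that t ≥ 0 is as small as possible.
  obtain ⟨k, t, hm, hlt⟩ : ∃ k t, m + t = p * (k + 1) ∧ p * k < m := by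
    have h1 := Nat.div_add_mod (m - 1) p
    have h2 := Nat.mod_lt (m - 1) hp
    refine ⟨(m - 1) / p, p * ((m - 1) / p + 1) - m, ?_, ?_⟩
    · rw [mul_add, mul_one]
      omega
    · omega
  rcases k.eq_zero_or_pos with rfl | hk
  · obtain ⟨h1, a, ha, x, hx⟩ := cartier_generator hpJ hp hf hf₁ hGs hG μ hu zero_lt_one hm
      (by simp) N
    refine ⟨fun w => ((m - 1).factorial : R) * (cartierPoly hp (mono u 1 * f ^ t)).coeff w,
      a, ha, x, ?_⟩
    rw [hx, act_eq_sum_subtype (P := μ.lattice)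
      (fun w hw => mem_lattice_of_mem_conePoints (h1 w hw)), Finset.smul_sum]
    simp only [smul_smul]
  · obtain ⟨d, hd⟩ := mul_factorial_dvd_factorial hp hk hlt
    obtain ⟨h1, a, ha, x, hx⟩ := cartier_generator hpJ hp hf hf₁ hGs hG μ hu k.succ_pos hm
      (by rw [hd, Nat.succ_sub_one, mul_assoc, mul_left_comm]; exact dvd_mul_right _ _) N
    refine ⟨0, _, Submodule.add_mem _ (Submodule.smul_mem _ (d : R)
      (factorial_smul_act_mem hf₁.lowest.isUnit h1)) ha, x, ?_⟩
    rw [hx, hd, smul_add, smul_smul, smul_smul, Nat.succ_sub_one]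
    simp only [Pi.zero_apply, zero_smul, Finset.sum_const_zero, zero_add]
    congr 3
    push_cast
    ring

theorem cartier_mem [Fact p.Prime] (hpJ : (p : R) ∈ (⊥ : Ideal R).jacobson)
    (hp : 0 < p) (hf : Companion l f₀ b f) (hf₁ : Companion l f₀ b f₁)
    (hGs : SupportedIn f₀ p G) (hG : substPow p f₁ = f ^ p + p * G) (μ : FaceOpen f₀) (N : ℕ)
    {y : (Fin n → ℤ) → R} (hy : y ∈ expansionSpan f b hf.lowest.isUnit (conePoints μ)) :
    ∃ c : μ.lattice → R, ∃ a ∈ expansionSpan f₁ b hf₁.lowest.isUnit (conePoints μ), ∃ x,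
      cartier p y = ∑ w : μ.lattice, c w • act (mono (w : Fin n → ℤ) 1)
        (series f₁ b hf₁.lowest.isUnit 1 1) + (p : R) • a + (p : R) ^ N • x := by
  induction hy using Submodule.span_induction with
  | mem y hy =>
    obtain ⟨⟨m, u⟩, hu, rfl⟩ := hy
    exact cartier_generator_mem hpJ hp hf hf₁ hGs hG μ hu N
  | zero => exact ⟨0, 0, Submodule.zero_mem _, 0, by simp⟩
  | add y z _ _ hy hz =>
    obtain ⟨c, a, ha, x, h⟩ := hy
    obtain ⟨c', a', ha', x', h'⟩ := hz
    refine ⟨c + c', _, Submodule.add_mem _ ha ha', x + x', ?_⟩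
    simp only [map_add, h, h', Pi.add_apply, add_smul, Finset.sum_add_distrib, smul_add]
    abel
  | smul r y _ hy =>
    obtain ⟨c, a, ha, x, h⟩ := hy
    refine ⟨r • c, _, Submodule.smul_mem _ r ha, r • x, ?_⟩
    simp only [map_smul, h, smul_add, Finset.smul_sum, Pi.smul_apply, smul_assoc, smul_comm r]

/-- The case m = k = 1, t = p - 1: the leading numerator is the Cartier image of x^u f^{p-1}, whose
coefficients form a row of the Hasse–Witt matrix. -/
theorem cartier_lattice [Fact p.Prime] (hpJ : (p : R) ∈ (⊥ : Ideal R).jacobson)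
    (hp : 0 < p) (hf : Companion l f₀ b f) (hf₁ : Companion l f₀ b f₁)
    (hGs : SupportedIn f₀ p G) (hG : substPow p f₁ = f ^ p + p * G) (μ : FaceOpen f₀) (N : ℕ)
    (u : μ.lattice) :
    ∃ a ∈ expansionSpan f₁ b hf₁.lowest.isUnit (conePoints μ), ∃ x,
      cartier p (act (mono (u : Fin n → ℤ) 1) (series f b hf.lowest.isUnit 1 1)) =
        ∑ w : μ.lattice, (f ^ (p - 1)).coeff ((p : ℤ) • (w : Fin n → ℤ) - u) •
          act (mono (w : Fin n → ℤ) 1) (series f₁ b hf₁.lowest.isUnit 1 1) +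
        (p : R) • a + (p : R) ^ N • x := by
  have hu : (1, (u : Fin n → ℤ)) ∈ conePoints μ := ⟨one_pos, _, u.2, by simp⟩
  obtain ⟨h1, a, ha, x, hx⟩ := cartier_generator hpJ hp hf hf₁ hGs hG μ hu zero_lt_one
    (t := p - 1) (by omega) (by simp) N
  refine ⟨a, ha, x, ?_⟩
  simp only [Nat.sub_self, Nat.factorial_zero, Nat.cast_one, one_smul] at hx
  rw [hx, act_eq_sum_subtype (P := μ.lattice)
    (fun w hw => mem_lattice_of_mem_conePoints (h1 w hw))]
  congr 3
  funext w
  rw [cartierPoly_coeff, AddMonoidAlgebra.coeff_single_mul_eq_mul_coeff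
    ((p : ℤ) • (w : Fin n → ℤ) - u), one_mul]
  intro m _
  rw [eq_sub_iff_add_eq, add_comm, natCast_zsmul]

/-- Multiplication by f turns the combination into the polynomial ∑ c_w x^{ν w}, whose coefficients
can be read off. -/
theorem dvd_of_sum_smul_eq {κ : Type*} [Fintype κ] {ν : κ → Fin n → ℤ}
    (hν : Function.Injective ν) (hu : IsUnit (f.coeff b)) (hv : IsVertex f b) (π : R)
    (c : κ → R) (x : (Fin n → ℤ) → R)
    (h : ∑ w, c w • act (mono (ν w) 1) (series f b hu 1 1) = π • x) (w : κ) : π ∣ c w := by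
  classical
  have h1 := congrArg (act f) h
  have h2 : ∀ w, act f (act (mono (ν w) 1) (series f b hu 1 1)) =
      ⇑(mono (ν w) (1 : R)).coeff := by
    intro w
    have := act_pow_series_self hv hu 1
    rw [pow_one] at this
    rw [← act_mul, mul_comm, act_mul, this, act_coeff, mul_one]
  simp only [map_sum, map_smul, h2] at h1
  have h3 := congrFun h1 (ν w)
  rw [Finset.sum_apply, Finset.sum_eq_single w] at h3
  · exact ⟨_, by simpa using h3⟩
  · intro v _ hne
    simp [AddMonoidAlgebra.coeff_single, hν.ne hne]
  · simp

end CartierExpansion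

/-! ### Formal derivatives through divisibility, and approximation in the completion. -/

section FormalDerivatives

variable {R : Type*} [CommRing R] {n : ℕ}

theorem mem_pIdeal_pow_smul_top {p s : ℕ} {r : R} :
    r ∈ (pIdeal R p ^ s • ⊤ : Submodule R R) ↔ (p : R) ^ s ∣ r := by
  rw [smul_eq_mul, Ideal.mul_top, Ideal.span_singleton_pow, Ideal.mem_span_singleton]

theorem eq_zero_of_forall_pow_dvd {p : ℕ} [IsHausdorff (pIdeal R p) R] {r : R}
    (h : ∀ s : ℕ, (p : R) ^ s ∣ r) : r = 0 :=
  IsHausdorff.haus (I := pIdeal R p) inferInstance r fun s => by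
    rw [SModEq.zero, mem_pIdeal_pow_smul_top]
    exact h s

theorem exists_nsmul_primitive {p : ℕ} (hp : 1 < p) {k : Fin n → ℤ} (hk : k ≠ 0) :
    ∃ (s : ℕ) (e : Fin n → ℤ), k = p ^ s • e ∧ ∃ i, ¬ (p : ℤ) ∣ e i := by
  classical
  obtain ⟨i, hi⟩ := Function.ne_iff.1 hk
  have hex : ∃ s : ℕ, ∃ i, ¬ (p : ℤ) ^ (s + 1) ∣ k i := by
    refine ⟨(k i).natAbs, i, fun h => ?_⟩
    have h1 := Int.natAbs_dvd_natAbs.2 h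
    rw [Int.natAbs_pow, Int.natAbs_natCast] at h1
    have h2 := Nat.le_of_dvd (Int.natAbs_pos.2 hi) h1
    have h3 := Nat.lt_pow_self hp (n := (k i).natAbs + 1)
    omega
  have hdvd : ∀ i, (p : ℤ) ^ Nat.find hex ∣ k i := by
    intro i
    rcases h : Nat.find hex with _ | s
    · simp
    · by_contra hne
      exact Nat.find_min hex (by omega : s < Nat.find hex) ⟨i, hne⟩
  choose e he using hdvd
  refine ⟨Nat.find hex, e, funext fun i => by simp [he i], ?_⟩
  obtain ⟨i, hi⟩ := Nat.find_spec hex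
  refine ⟨i, fun ⟨c, hc⟩ => hi ⟨c, ?_⟩⟩
  rw [he i, hc, pow_succ, mul_assoc]

theorem isUnit_intCast_of_not_dvd {p : ℕ} (hp : p.Prime)
    (hpJ : (p : R) ∈ (⊥ : Ideal R).jacobson) {c : ℤ} (h : ¬ (p : ℤ) ∣ c) : IsUnit (c : R) := by
  have h1 := isUnit_natCast_of_coprime hpJ
    ((Nat.Prime.coprime_iff_not_dvd hp).2 fun h' => h (Int.natCast_dvd.2 h'))
  rcases Int.natAbs_eq c with h2 | h2
  · rw [h2, Int.cast_natCast]
    exact h1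
  · rw [h2, Int.cast_neg, Int.cast_natCast]
    exact h1.neg

/-- The formal derivatives are the formal series whose coefficients at `x ^ k` are divisible by the
powers of `p` that divide `k`. -/
theorem mem_dOmegaFormal_iff {p : ℕ} (hp : p.Prime) [IsHausdorff (pIdeal R p) R]
    (hpJ : (p : R) ∈ (⊥ : Ideal R).jacobson) {f : Laurent R n} {b : Fin n → ℤ}
    {a : (Fin n → ℤ) → R} (ha : a ∈ OmegaFormal f b) :
    a ∈ dOmegaFormal f b ↔ ∀ (s : ℕ) (e : Fin n → ℤ), (p : R) ^ s ∣ a (p ^ s • e) := by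
  constructor
  · intro h s
    clear ha
    induction h using Submodule.span_induction with
    | mem a h =>
      obtain ⟨i, a', _, rfl⟩ := h
      intro e
      refine ⟨e i * a' (p ^ s • e), ?_⟩
      simp [theta, mul_assoc]
    | zero => simp
    | add x y _ _ hx hy => exact fun e => dvd_add (hx e) (hy e)
    | smul r x _ hx => exact fun e => Dvd.dvd.mul_left (hx e) r
  · intro h
    -- Write k = p^s e with e_i prime to p; then a_k = p^s t = k_i (t / e_i). For k = 0 all powers
    -- of p divide a_0, so it vanishes. Taking c = 0 where a_k = 0 keeps the primitives supported in
    -- the cone.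
    have key : ∀ k, ∃ c : Fin n → R, a k = ∑ i, (k i : R) * c i ∧ (a k = 0 → c = 0) := by
      intro k
      by_cases h0 : a k = 0
      · exact ⟨0, by simp [h0], fun _ => rfl⟩
      · have hk : k ≠ 0 := by
          rintro rfl
          exact h0 (eq_zero_of_forall_pow_dvd (p := p) fun s => by simpa using h s 0)
        obtain ⟨s, e, rfl, i, hi⟩ := exists_nsmul_primitive hp.one_lt hk
        obtain ⟨t, ht⟩ := h s e
        obtain ⟨v, hv⟩ := (isUnit_intCast_of_not_dvd hp hpJ hi).exists_right_inv
        refine ⟨Pi.single i (v * t), ?_, fun h => absurd h h0⟩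
        rw [Finset.sum_eq_single i (fun j _ hj => by simp [hj]) (by simp), ht]
        simp only [Pi.single_eq_same, Pi.smul_apply, nsmul_eq_mul]
        push_cast
        rw [mul_assoc, ← mul_assoc (e i : R), hv, one_mul]
    choose c hc hc0 using key
    have hsum : a = ∑ i, theta i fun k => c k i := by
      funext k
      rw [hc k, Finset.sum_apply]
      rfl
    rw [hsum]
    refine Submodule.sum_mem _ fun i _ => Submodule.subset_span ⟨i, _, fun k hk => ha k ?_, rfl⟩
    exact fun h => hk (by rw [hc0 k h]; rfl)

theorem mem_divisibleUpTo_cartier_iff {p s : ℕ} {a : (Fin n → ℤ) → R} :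
    a ∈ divisibleUpTo (p : R) (cartier p) s ↔
      ∀ t ≤ s, ∀ e : Fin n → ℤ, (p : R) ^ t ∣ a (p ^ t • e) := by
  constructor
  · intro h t ht e
    obtain ⟨y, hy⟩ := h t ht
    exact ⟨y e, by rw [← cartier_pow_apply p t a e, hy]; rfl⟩
  · intro h t ht
    choose y hy using h t ht
    exact ⟨y, funext fun e => by rw [cartier_pow_apply, hy]; rfl⟩

theorem pow_smul_mem_divisibleUpTo {p s : ℕ} (x : (Fin n → ℤ) → R) :
    (p : R) ^ s • x ∈ divisibleUpTo (p : R) (cartier p) s := by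
  rw [mem_divisibleUpTo_cartier_iff]
  exact fun t ht e => Dvd.dvd.mul_right (pow_dvd_pow _ ht) _

theorem divisibleUpTo_antitone {p s t : ℕ} (h : s ≤ t) :
    divisibleUpTo (p : R) (cartier (R := R) (n := n) p) t ≤ divisibleUpTo (p : R) (cartier p) s :=
  fun _ ha r hr => ha r (hr.trans h)

/-- A representative of ω modulo p^s has the right expansion modulo p^s, coefficient by coefficient.
This reduces statements about the completion to Ω_f(μ) itself. -/
theorem exists_expandHat_eq {p : ℕ} [IsAdicComplete (pIdeal R p) R] {f : Laurent R n}
    {b : Fin n → ℤ} (hv : IsVertex f b) (hu : IsUnit (f.coeff b)) (μ : FaceOpen f)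
    (ω : OmegaHat p μ) (s : ℕ) :
    ∃ r ∈ Omega μ, ∃ x, expandHat p f b hv hu μ ω = expand f b hv hu r + (p : R) ^ s • x := by
  obtain ⟨r, hr⟩ := Submodule.mkQ_surjective _ (AdicCompletion.eval (pIdeal R p) (Omega μ) s ω)
  have key : ∀ k, (p : R) ^ s ∣ expandHat p f b hv hu μ ω k - expand f b hv hu r k := by
    intro k
    rw [← mem_pIdeal_pow_smul_top, ← SModEq.sub_mem, SModEq]
    set φ : Omega μ →ₗ[R] R := LinearMap.proj k ∘ₗ expand f b hv hu ∘ₗ (Omega μ).subtype with hφ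
    have h1 : AdicCompletion.of (pIdeal R p) R (expandHat p f b hv hu μ ω k) =
        AdicCompletion.map (pIdeal R p) φ ω :=
      AdicCompletion.of_ofLinearEquiv_symm _ _
    have h2 := congrArg (AdicCompletion.eval (pIdeal R p) R s) h1
    rw [AdicCompletion.eval_of, AdicCompletion.eval_apply, AdicCompletion.map_val_apply,
      ← AdicCompletion.eval_apply, ← hr] at h2
    exact h2
  choose x hx using key
  exact ⟨r, r.2, x, funext fun k => sub_eq_iff_eq_add'.1 (hx k)⟩

end FormalDerivatives

/-! ### Conjugates of f and of the Hasse–Witt matrix. -/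

section UnitRoot

variable {R : Type*} [CommRing R] {n : ℕ}

/-- The conjugates `f^{σ^j}`. -/
def iterTwist (σ : R →+* R) (f : Laurent R n) : ℕ → Laurent R n
  | 0 => f
  | j + 1 => twist σ (iterTwist σ f j)

theorem isUnit_hasseWitt_iterTwist (σ : R →+* R) {f : Laurent R n} {p : ℕ} {μ : FaceOpen f}
    (h : IsUnit (hasseWitt p f μ)) (j : ℕ) :
    IsUnit (Matrix.of fun u v : μ.lattice =>
      (iterTwist σ f j ^ (p - 1)).coeff ((p : ℤ) • (v : Fin n → ℤ) - (u : Fin n → ℤ))) := by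
  induction j with
  | zero => exact h
  | succ j ih =>
    convert ih.map σ.mapMatrix using 1
    ext u v
    rw [iterTwist, ← map_pow]
    exact AddMonoidAlgebra.coeff_mapRingHom _ _ _

end UnitRoot

end UnitRootCrystal

end

/-! ### The basis of the quotient. -/

open UnitRootCrystal
theorem theorem4p5 {R : Type*} [CommRing R] [IsDomain R] [CharZero R]
    (p : ℕ) [Fact p.Prime] (hp : 2 < p) [IsAdicComplete (pIdeal R p) R]
    (σ : R →+* R) (hσ : ∀ r : R, σ r - r ^ p ∈ pIdeal R p)
    {n : ℕ} (f : Laurent R n)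
    (b : Fin n → ℤ) (hb : IsVertex f b) (hfb : IsUnit (f.coeff b))
    (μ : FaceOpen f) (hβ : IsUnit (hasseWitt p f μ)) :
    Module.Free R (Q p f b hb hfb μ) ∧
    Module.finrank R (Q p f b hb hfb μ) = Nat.card μ.lattice ∧
    ∃ B : Module.Basis μ.lattice R (Q p f b hb hfb μ),
      ∀ u : μ.lattice, B u = omegaClass p f b hb hfb μ u := by
  classical
  have hpp : p.Prime := Fact.out
  have hp0 : 0 < p := hpp.pos
  have hpJ : (p : R) ∈ (⊥ : Ideal R).jacobson :=
    IsAdicComplete.le_jacobson_bot (pIdeal R p) (Ideal.mem_span_singleton_self _)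
  obtain ⟨l, hl⟩ := exists_functional hb
  have hcomp : ∀ j, Companion l f b (iterTwist σ f j) := by
    intro j
    induction j with
    | zero => exact ⟨⟨hfb, hl⟩, hb, fun _ => id⟩
    | succ j ih => exact ih.twist σ
  have hG : ∀ j, ∃ G, substPow p (iterTwist σ f (j + 1)) = iterTwist σ f j ^ p + p * G :=
    fun j => exists_substPow_twist_eq hpp hσ _
  choose G hG using hG
  have hGs : ∀ j, SupportedIn f p (G j) := fun j =>
    supportedIn_of_substPow_eq hp0 ⟨_, hb.1⟩ (SupportedIn.of_newton (hcomp j).support)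
      (SupportedIn.of_newton (hcomp (j + 1)).support) (hG j)
  -- All conjugates use the cone and the lattice points of μ for the original f, so the index set of
  -- the matrices does not vary with j.
  set A : ℕ → Submodule R ((Fin n → ℤ) → R) := fun j =>
    expansionSpan (iterTwist σ f j) b (hcomp j).lowest.isUnit (conePoints μ) with hA
  set e : ℕ → μ.lattice → (Fin n → ℤ) → R := fun j u =>
    act (mono (u : Fin n → ℤ) 1) (series (iterTwist σ f j) b (hcomp j).lowest.isUnit 1 1) with he
  have H1 : ∀ j s, ∀ a ∈ A j, ∃ c : μ.lattice → R, ∃ a' ∈ A (j + 1), ∃ x,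
      cartier p a = ∑ u, c u • e (j + 1) u + (p : R) • a' + (p : R) ^ s • x := fun j s a ha =>
    cartier_mem hpJ hp0 (hcomp j) (hcomp (j + 1)) (hGs j) (hG j) μ s ha
  have H2 := fun j s u =>
    cartier_lattice hpJ hp0 (hcomp j) (hcomp (j + 1)) (hGs j) (hG j) μ s u
  have hβ' := isUnit_hasseWitt_iterTwist σ hβ
  have hspan := exists_coeff_divisibleUpTo (e := e) hpJ hβ' H1 H2
  have hF : ∀ x y : (Fin n → ℤ) → R, (p : R) • x = (p : R) • y → x = y := fun x y h =>
    funext fun k => mul_left_cancel₀ (Nat.cast_ne_zero.2 hp0.ne') (congrFun h k)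
  have huniq := fun s => coeff_mem_of_divisibleUpTo (e := e) hpJ hβ' H1 H2 hF
    (fun j c x h => dvd_of_sum_smul_eq Subtype.val_injective (hcomp j).lowest.isUnit
      (hcomp j).isVertex _ c x h) s 0
  have hof : ∀ u : μ.lattice, expandHat p f b hb hfb μ
      (AdicCompletion.of (pIdeal R p) (Omega μ) ⟨omega f 1 u, omega_mem μ u⟩) = e 0 u := by
    intro u
    rw [expandHat_of]
    simp only [expand_omega, Nat.sub_self, Nat.factorial_zero, Nat.cast_one, one_smul]
    rfl
  have heF : ∀ u, e 0 u ∈ OmegaFormal f b := by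
    intro u
    refine expansionSpan_le_omegaFormal hb hfb μ ?_
    rw [← hof, expandHat_of]
    exact expand_mem_expansionSpan hb hfb μ (omega_mem μ u)
  -- Outside the cone a coefficient vanishes modulo every p^s, hence vanishes.
  have hexF : ∀ ω, expandHat p f b hb hfb μ ω ∈ OmegaFormal f b := by
    intro ω k hk
    by_contra hne
    refine hk (eq_zero_of_forall_pow_dvd (p := p) fun s => ?_)
    obtain ⟨r, hr, x, hx⟩ := exists_expandHat_eq hb hfb μ ω s
    have h0 : expand f b hb hfb r k = 0 := by
      by_contra h0
      exact hne (expansionSpan_le_omegaFormal hb hfb μ (expand_mem_expansionSpan hb hfb μ hr) k h0)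
    rw [hx, Pi.add_apply, h0, zero_add]
    exact dvd_mul_right _ _
  have hd : ∀ a ∈ OmegaFormal f b, a ∈ dOmegaFormal f b ↔
      ∀ s, a ∈ divisibleUpTo (p : R) (cartier p) s := by
    intro a ha
    rw [mem_dOmegaFormal_iff hpp hpJ ha]
    simp only [mem_divisibleUpTo_cartier_iff]
    exact ⟨fun h s t _ => h t, fun h s => h s s le_rfl⟩
  have hli : LinearIndependent R (omegaClass p f b hb hfb μ) := by
    rw [Fintype.linearIndependent_iff]
    intro c hc u
    simp only [omegaClass, ← map_smul, ← map_sum] at hc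
    rw [Submodule.mkQ_apply, Submodule.Quotient.mk_eq_zero, U, Submodule.mem_comap] at hc
    simp only [map_sum, map_smul, hof] at hc
    rw [hd _ (Submodule.sum_mem _ fun u _ => Submodule.smul_mem _ _ (heF u))] at hc
    exact eq_zero_of_forall_pow_dvd (p := p) fun s => huniq s c (hc s) u
  have hsp : ⊤ ≤ Submodule.span R (Set.range (omegaClass p f b hb hfb μ)) := by
    intro q _
    obtain ⟨ω, rfl⟩ := Submodule.mkQ_surjective _ q
    have h1 : ∀ s, ∃ c : μ.lattice → R, expandHat p f b hb hfb μ ω - ∑ u, c u • e 0 u ∈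
        divisibleUpTo (p : R) (cartier p) s := by
      intro s
      obtain ⟨r, hr, x, hx⟩ := exists_expandHat_eq hb hfb μ ω s
      rw [hx]
      exact hspan s 0 _ (expand_mem_expansionSpan hb hfb μ hr) x
    choose c hc using h1
    have h2 : ∀ u, ∃ L : R, ∀ s, (p : R) ^ s ∣ c s u - L := by
      intro u
      obtain ⟨L, hL⟩ := IsPrecomplete.prec (I := pIdeal R p) (M := R) inferInstance
        (f := fun s => c s u) (by
          intro s t hst
          rw [SModEq.sub_mem, mem_pIdeal_pow_smul_top]
          -- Both coefficient vectors approximate the same expansion up to level s, so uniqueness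
          -- makes the sequence Cauchy.
          refine huniq s (c s - c t) ?_ u
          have := Submodule.sub_mem _ (divisibleUpTo_antitone hst (hc t)) (hc s)
          rw [sub_sub_sub_cancel_left, ← Finset.sum_sub_distrib] at this
          simpa only [Pi.sub_apply, sub_smul] using this)
      exact ⟨L, fun s => mem_pIdeal_pow_smul_top.1 (SModEq.sub_mem.1 (hL s))⟩
    choose L hL using h2
    have h3 : ∀ s, expandHat p f b hb hfb μ ω - ∑ u, L u • e 0 u ∈
        divisibleUpTo (p : R) (cartier p) s := by
      intro s
      -- Passing to the limit changes the combination by a multiple of p^s, which satisfies the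
      -- conditions up to s.
      have h4 : ∑ u, (c s u - L u) • e 0 u ∈ divisibleUpTo (p : R) (cartier p) s := by
        refine Submodule.sum_mem _ fun u _ => ?_
        obtain ⟨d, hd⟩ := hL u s
        rw [hd, mul_smul]
        exact pow_smul_mem_divisibleUpTo _
      have h5 := Submodule.add_mem _ (hc s) h4
      simp only [sub_smul, Finset.sum_sub_distrib] at h5
      rwa [sub_add_sub_cancel] at h5
    have h6 : (U p f b hb hfb μ).mkQ ω = ∑ u, L u • omegaClass p f b hb hfb μ u := by
      simp only [omegaClass, ← map_smul, ← map_sum]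
      rw [← sub_eq_zero, ← map_sub, Submodule.mkQ_apply, Submodule.Quotient.mk_eq_zero, U,
        Submodule.mem_comap, map_sub]
      simp only [map_sum, map_smul, hof]
      rw [hd _ (Submodule.sub_mem _ (hexF ω)
        (Submodule.sum_mem _ fun u _ => Submodule.smul_mem _ _ (heF u)))]
      exact h3
    rw [h6]
    exact Submodule.sum_mem _ fun u _ => Submodule.smul_mem _ _ (Submodule.subset_span ⟨u, rfl⟩)
  set B := Module.Basis.mk hli hsp with hB
  exact ⟨Module.Free.of_basis B, Module.finrank_eq_nat_card_basis B, B,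
    fun u => Module.Basis.mk_apply hli hsp u⟩
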